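/- **Setting.** Let $n=2r$. For $a\in\mathbb Z^n$, $\ell\in\mathbb N^n$ let $P_{a,\ell}=\{x\in\mathbb Z^n: a_k\le x_k<a_k+\ell_k\ \forall k\}$. The lower and upper frequencies $\mathbf F_*(A)$, $\mathbf F^*(A)$ of a set $A\subset\mathbb Z^n$ are the lower and upper limits of $\#(A\cap P_{a,\ell})/\#P_{a,\ell}$ as $\min_k\ell_k\to\infty$ (uniformly in $a$); $A$ is *frequency measurable* if they coincide, and the common value is its frequency $\mathbf F(A)$. A map $g:\mathbb Z^n\to\mathbb R^n$ is *$D$-distributed*, for a Borel probability measure $D$ on $\mathbb R^n$, if for every Borel set $B$ with $D(\partial B)=0$ the set $g^{-1}(B)$ is frequency measurable and $\mathbf F(g^{-1}(B))=D(B)$. A set is *Jordan measurable* if it is bounded and its boundary has Lebesgue measure zero. A *quantizer* is a map $R:\mathbb R^n\to\mathbb Z^n$ with $R(u+z)=R(u)+z$ for all $u\in\mathbb R^n$, $z\in\mathbb Z^n$, such that $R^{-1}(0)$ is Jordan measurable. Put $$\mu=\int_{R^{-1}(0)}u\,du,\qquad \Psi=\int_{R^{-1}(0)}(u-\mu)(u-\mu)^{T}du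 .$$ Given a nonsingular matrix $L\in\mathbb R^{n\times n}$, let $T=R\circ L:\mathbb Z^n\to\mathbb Z^n$ be the quantized linear system, $T_*(u)=Lu-\mu$ on $\mathbb R^n$ its supporting system, and $\delta_N(x)=T_*^N(x)-T^N(x)$ for $x\in\mathbb Z^n$. The matrix $L$ is *iteratively nonresonant* if, for any finitely many distinct rows of the infinite matrix obtained by stacking all powers $L^k$, $k\in\mathbb Z\setminus\{0\}$, these rows together with the rows of $I_n$ are linearly independent over $\mathbb Q$. Suppose that $L=\sum_{k=1}^r U_kJ_kV_k$, where $U=[U_1\ \dots\ U_r]\in\mathbb R^{n\times n}$ is nonsingular with blocks $U_k\in\mathbb R^{n\times2}$, $V_k\in\mathbb R^{2\times n}$ are the corresponding blocks of rows of $U^{-1}$, and $J_k$ is the matrix of planar rotation by an angle $\theta_k\in(0,2\pi)$. **Theorem.** Suppose $L$ is iteratively nonresonant and has a nondegenerate spectrum, that is, the $2r$ numbers $e^{\pm i\theta_k}$, $1\le k\le r$, are pairwise different. Let $R$ be any quantizer. Then the limit $$\Phi:=\lim_{N\to\infty}\frac1N\sum_{\ell=1}^N L^{-\ell}\Psi(L^{-\ell})^{T}=\frac12\sum_{k=1}^r\sigma_k^2U_kU_k^{T},\qquad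 \sigma_k=\sqrt{\operatorname{Tr}(V_k\Psi V_k^{T})},$$ exists and is positive definite. For every real $n\times n$ matrix $\sqrt\Phi$ with $\sqrt\Phi\,(\sqrt\Phi)^{T}=\Phi$ (for example $\sqrt\Phi=\frac1{\sqrt2}[\sigma_1U_1\ \dots\ \sigma_rU_r]$), and with $\Phi^{-1/2}:=(\sqrt\Phi)^{-1}$, the following holds. There are Borel probability measures $D_N$ on $\mathbb R^n$ such that, for every $N\ge1$, the map $\frac1{\sqrt N}\Phi^{-1/2}\delta_N:\mathbb Z^n\to\mathbb R^n$ is $D_N$-distributed, and $D_N$ converges weakly, as $N\to\infty$, to the Gaussian measure on $\mathbb R^n$ with zero mean and identity covariance matrix. Moreover, for every Jordan measurable set $B\subset\mathbb R^n$, the sets $\{x\in\mathbb Z^n:\frac1{\sqrt N}\Phi^{-1/2}\delta_N(x)\in B\}$, $N\ge1$, are frequency measurable and $$\lim_{N\to\infty}\mathbf F\Big\{x\in\mathbb Z^n:\ \frac1{\sqrt N}\Phi^{-1/2}\delta_N(x)\in B\Big\}=(2\pi)^{-n/2}\int_B e^{-|u|^2/2}\,du .$$ -/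

import Mathlib

open Filter Topology MeasureTheory ProbabilityTheory
open scoped Matrix

namespace QuantizedLinear

noncomputable section

/-! Frequencies of subsets of the integer lattice. -/

/-- The discrete parallelepiped of lattice points `x` with `a k ≤ x k < a k + ℓ k` for all `k`. -/
def box {n : ℕ} (a : Fin n → ℤ) (ℓ : Fin n → ℕ) : Finset (Fin n → ℤ) :=
  Fintype.piFinset fun k => Finset.Ico (a k) (a k + (ℓ k : ℤ))

/-- The filter of unboundedly growing parallelepipeds: it is generated by the classes of all
parallelepipeds (located anywhere) whose edge lengths are at least `N`. -/
def boxFilter (n : ℕ) : Filter (Finset (Fin n → ℤ)) :=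
  ⨅ N : ℕ, 𝓟 {P | ∃ (a : Fin n → ℤ) (ℓ : Fin n → ℕ), (∀ k, N ≤ ℓ k) ∧ P = box a ℓ}

open Classical in
/-- The fraction of the points of `P` that lie in `A`. -/
def fraction {n : ℕ} (A : Set (Fin n → ℤ)) (P : Finset (Fin n → ℤ)) : ℝ :=
  ((P.filter fun x => x ∈ A).card : ℝ) / (P.card : ℝ)

/-- Lower frequency. -/
def lowerFreq {n : ℕ} (A : Set (Fin n → ℤ)) : ℝ := liminf (fraction A) (boxFilter n)

/-- Upper frequency. -/
def upperFreq {n : ℕ} (A : Set (Fin n → ℤ)) : ℝ := limsup (fraction A) (boxFilter n)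

/-- A set is frequency measurable if its lower and upper frequencies coincide. -/
def FreqMeasurable {n : ℕ} (A : Set (Fin n → ℤ)) : Prop := lowerFreq A = upperFreq A

/-- The frequency of a frequency measurable set is the common value of the lower and upper
frequencies; it is only used together with `FreqMeasurable`. -/
def freq {n : ℕ} (A : Set (Fin n → ℤ)) : ℝ := upperFreq A

/-- A map `g` from the lattice to a topological space is `D`-distributed if the preimage of every
Borel set `B` with `D (∂B) = 0` is frequency measurable with frequency `D B`. -/
def IsDistributed {n : ℕ} {X : Type*} [TopologicalSpace X] [MeasurableSpace X] [BorelSpace X]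
    (g : (Fin n → ℤ) → X) (D : ProbabilityMeasure X) : Prop :=
  ∀ B : Set X, MeasurableSet B → (D : Measure X) (frontier B) = 0 →
    FreqMeasurable (g ⁻¹' B) ∧ freq (g ⁻¹' B) = (D : Measure X).real B

/-- Jordan measurable sets: bounded sets with a Lebesgue null boundary. -/
def JordanMeasurable {n : ℕ} (B : Set (Fin n → ℝ)) : Prop :=
  Bornology.IsBounded B ∧ volume (frontier B) = 0

/-! Quantized linear systems and their supporting systems. -/

/-- The inclusion of the lattice into Euclidean space. -/
def toReal {n : ℕ} (x : Fin n → ℤ) : Fin n → ℝ := fun i => (x i : ℝ)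

/-- The set `R⁻¹(0)`. -/
def cell {n : ℕ} (R : (Fin n → ℝ) → (Fin n → ℤ)) : Set (Fin n → ℝ) := R ⁻¹' {0}

/-- Quantizers: maps to the lattice which commute with integer translations and have a Jordan
measurable set `R⁻¹(0)`. -/
structure IsQuantizer {n : ℕ} (R : (Fin n → ℝ) → (Fin n → ℤ)) : Prop where
  map_add : ∀ (u : Fin n → ℝ) (z : Fin n → ℤ), R (u + toReal z) = R u + z
  jordan : JordanMeasurable (cell R)

/-- The transition operator `T = R ∘ L` of the quantized linear `(R, L)`-system. -/
def transition {n : ℕ} (R : (Fin n → ℝ) → (Fin n → ℤ)) (L : Matrix (Fin n) (Fin n) ℝ)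
    (x : Fin n → ℤ) : Fin n → ℤ :=
  R (L *ᵥ toReal x)

/-- The mean vector `μ` of the uniform distribution over the cell. -/
def cellMean {n : ℕ} (R : (Fin n → ℝ) → (Fin n → ℤ)) : Fin n → ℝ :=
  fun i => ∫ u in cell R, u i

/-- The covariance matrix `Ψ` of the uniform distribution over the cell. -/
def cellCov {n : ℕ} (R : (Fin n → ℝ) → (Fin n → ℤ)) : Matrix (Fin n) (Fin n) ℝ :=
  Matrix.of fun i j => ∫ u in cell R, (u i - cellMean R i) * (u j - cellMean R j)

/-- The transition operator `T_* (u) = L u - μ` of the supporting system. -/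
def supporting {n : ℕ} (R : (Fin n → ℝ) → (Fin n → ℤ)) (L : Matrix (Fin n) (Fin n) ℝ)
    (u : Fin n → ℝ) : Fin n → ℝ :=
  L *ᵥ u - cellMean R

/-- The deviation `δ_N (x) = T_*^N (x) - T^N (x)`. -/
def deviation {n : ℕ} (R : (Fin n → ℝ) → (Fin n → ℤ)) (L : Matrix (Fin n) (Fin n) ℝ)
    (N : ℕ) (x : Fin n → ℤ) : Fin n → ℝ :=
  (supporting R L)^[N] (toReal x) - toReal ((transition R L)^[N] x)

/-! Nonresonance. -/

/-- A matrix `Λ` is nonresonant if the rows of `I` stacked on `Λ` are linearly independent over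
the rationals. -/
def Nonresonant {m n : ℕ} (Λ : Matrix (Fin m) (Fin n) ℝ) : Prop :=
  LinearIndependent ℚ (Matrix.fromRows (1 : Matrix (Fin n) (Fin n) ℝ) Λ).row

/-- A matrix with an arbitrary set of rows is nonresonant if all matrices formed from finitely many
of its (distinct) rows are nonresonant. -/
def InfNonresonant {ι : Type*} {n : ℕ} (M : Matrix ι (Fin n) ℝ) : Prop :=
  ∀ (m : ℕ) (f : Fin m ↪ ι), Nonresonant (M.submatrix f id)

/-- The infinite matrix formed by stacking all the nonzero integer powers of `L`. -/
def stackedPowers {n : ℕ} (L : Matrix (Fin n) (Fin n) ℝ) :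
    Matrix ({k : ℤ // k ≠ 0} × Fin n) (Fin n) ℝ :=
  Matrix.of fun p j => (L ^ (p.1 : ℤ)) p.2 j

/-- Iteratively nonresonant matrices. -/
def IterNonresonant {n : ℕ} (L : Matrix (Fin n) (Fin n) ℝ) : Prop :=
  IsUnit L.det ∧ InfNonresonant (stackedPowers L)

/-! The neutral class, in dimension `r * 2`. -/

/-- The planar rotation matrix. -/
def rotation (t : ℝ) : Matrix (Fin 2) (Fin 2) ℝ :=
  !![Real.cos t, -Real.sin t; Real.sin t, Real.cos t]

/-- The block `U_k` of two consecutive columns of `U = [U_1 … U_r]`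
(here `finProdFinEquiv (k, j)` is the index `2 k + j`). -/
def colBlock {r : ℕ} (U : Matrix (Fin (r * 2)) (Fin (r * 2)) ℝ) (k : Fin r) :
    Matrix (Fin (r * 2)) (Fin 2) ℝ :=
  U.submatrix id fun j => finProdFinEquiv (k, j)

/-- The block `V_k` of two consecutive rows of `U⁻¹`. -/
def rowBlock {r : ℕ} (U : Matrix (Fin (r * 2)) (Fin (r * 2)) ℝ) (k : Fin r) :
    Matrix (Fin 2) (Fin (r * 2)) ℝ :=
  U⁻¹.submatrix (fun j => finProdFinEquiv (k, j)) id

/-- The matrix `L = ∑ U_k J_k V_k`. -/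
def neutralMatrix {r : ℕ} (U : Matrix (Fin (r * 2)) (Fin (r * 2)) ℝ) (θ : Fin r → ℝ) :
    Matrix (Fin (r * 2)) (Fin (r * 2)) ℝ :=
  ∑ k, colBlock U k * rotation (θ k) * rowBlock U k

/-- The `2 r` numbers `exp (± i θ_k)` are pairwise different. -/
def NondegenerateSpectrum {r : ℕ} (θ : Fin r → ℝ) : Prop :=
  Function.Injective
    (Sum.elim (fun k : Fin r => Complex.exp ((θ k : ℂ) * Complex.I))
      (fun k : Fin r => Complex.exp (-((θ k : ℂ) * Complex.I))))

/-- `σ_k = √ Tr (V_k Ψ V_kᵀ)`. -/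
def sigma {r : ℕ} (U Ψ : Matrix (Fin (r * 2)) (Fin (r * 2)) ℝ) (k : Fin r) : ℝ :=
  √(rowBlock U k * Ψ * (rowBlock U k)ᵀ).trace

/-- `Φ = (1/2) ∑ σ_k² U_k U_kᵀ`. -/
def limitCov {r : ℕ} (U Ψ : Matrix (Fin (r * 2)) (Fin (r * 2)) ℝ) :
    Matrix (Fin (r * 2)) (Fin (r * 2)) ℝ :=
  (1 / 2 : ℝ) • ∑ k, (sigma U Ψ k) ^ 2 • (colBlock U k * (colBlock U k)ᵀ)

/-- The average `(1/N) ∑_{ℓ = 1}^N L^{-ℓ} Ψ (L^{-ℓ})ᵀ`. -/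
def averagedCov {n : ℕ} (L Ψ : Matrix (Fin n) (Fin n) ℝ) (N : ℕ) : Matrix (Fin n) (Fin n) ℝ :=
  (1 / (N : ℝ)) • ∑ ℓ ∈ Finset.Icc 1 N, L ^ (-(ℓ : ℤ)) * Ψ * (L ^ (-(ℓ : ℤ)))ᵀ

/-- The particular square root `(1/√2) [σ_1 U_1 … σ_r U_r]` of `Φ`. -/
def blockRoot {r : ℕ} (U Ψ : Matrix (Fin (r * 2)) (Fin (r * 2)) ℝ) :
    Matrix (Fin (r * 2)) (Fin (r * 2)) ℝ :=
  Matrix.of fun i p => (1 / √2) * sigma U Ψ (finProdFinEquiv.symm p).1 * U i p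

/-- `blockRoot` is a matrix square root of `Φ`. -/
theorem blockRoot_mul_transpose {r : ℕ} (U Ψ : Matrix (Fin (r * 2)) (Fin (r * 2)) ℝ) :
    blockRoot U Ψ * (blockRoot U Ψ)ᵀ = limitCov U Ψ := by
  have h2 : (√2 : ℝ)⁻¹ * (√2)⁻¹ = 1 / 2 := by
    rw [← mul_inv, Real.mul_self_sqrt (by norm_num)]; norm_num
  ext i j
  simp only [limitCov, blockRoot, Matrix.mul_apply, Matrix.transpose_apply, Matrix.of_apply,
    Matrix.smul_apply, Matrix.sum_apply, colBlock, Matrix.submatrix_apply, id_eq, smul_eq_mul]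
  rw [← finProdFinEquiv.sum_comp, Fintype.sum_prod_type, Finset.mul_sum]
  refine Finset.sum_congr rfl fun k _ => ?_
  rw [Finset.mul_sum, Finset.mul_sum]
  refine Finset.sum_congr rfl fun l _ => ?_
  rw [Equiv.symm_apply_apply, ← h2]
  ring

/-- The map `N^{-1/2} S⁻¹ δ_N`. -/
def normalizedDeviation {n : ℕ} (R : (Fin n → ℝ) → (Fin n → ℤ)) (L S : Matrix (Fin n) (Fin n) ℝ)
    (N : ℕ) (x : Fin n → ℤ) : Fin n → ℝ :=
  (1 / √(N : ℝ)) • (S⁻¹ *ᵥ deviation R L N x)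

/-- The Gaussian measure with zero mean vector and identity covariance matrix. -/
def standardGaussian (n : ℕ) : ProbabilityMeasure (Fin n → ℝ) :=
  ⟨Measure.pi fun _ => gaussianReal 0 1, inferInstance⟩

end

end QuantizedLinear

open QuantizedLinear

namespace QuantizedLinear

open scoped ENNReal

/-! ### Frequencies -/

/-! The quantization errors `e_k = L T^k x - T^(k+1) x` lie in the cell, and unrolling the recursion
gives `δ_N(x) = ∑_{k<N} L^(N-1-k) (e_k - μ)` (`deviation_eq_sum`). The theorem is therefore a
central limit theorem, once the errors are shown to behave like independent vectors uniform over the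
cell.

Independence comes from equidistribution. Telescoping gives `∑_{j≤k} L^(k-j) e_j = L^(k+1) x -
T^(k+1) x`, which modulo the lattice is `L^(k+1) x` (`shear_errors`). Modulo the lattice, the
triangular map on the left is a bijection from the `N`-fold product of the cell onto the torus, and
it sends the product of uniform laws to a measure with no nontrivial Fourier coefficients. By
nonresonance and Weyl's criterion, `x ↦ (L x, …, L^N x)` is equidistributed for that measure.
Pulling back through the bijection, the frequency of an error pattern is its probability under
independent uniform errors (`tendsto_fraction_errors`). Null boundaries survive the transfer because
the torus map is continuous and open.

Hence `δ_N`, normalized, is distributed as a weighted sum of independent bounded vectors with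
weights `N^(-1/2) S⁻¹ L^(N-1-k)`. These are `O(N^(-1/2))`, since the powers of `L` are
simultaneously conjugate to block rotations. So a comparison of characteristic functions gives the
Gaussian limit (`tendsto_weightedLaw`) as soon as the covariances converge to the identity.

For the covariances, each pair of blocks `(k, l)` contributes rotations by multiples of `θ_k - θ_l`
and `θ_k + θ_l`. Nondegeneracy makes all of these average to zero except the difference term with `k
= l`, and what remains is `Φ` (`tendsto_mean_conj_neutral`). Finally, for `N ≥ 1` the laws of the
weighted sums give no mass to closed Lebesgue null sets, which covers Jordan measurable sets. -/

theorem boxFilter_hasBasis (n : ℕ) : (boxFilter n).HasBasis (fun _ : ℕ => True)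
    fun N => {P | ∃ (a : Fin n → ℤ) (ℓ : Fin n → ℕ), (∀ k, N ≤ ℓ k) ∧ P = box a ℓ} := by
  refine hasBasis_iInf_principal (directed_of_isDirected_le ?_)
  rintro i j hij P ⟨a, ℓ, h, rfl⟩
  exact ⟨a, ℓ, fun k => hij.trans (h k), rfl⟩

instance boxFilter_neBot (n : ℕ) : (boxFilter n).NeBot :=
  (boxFilter_hasBasis n).neBot_iff.2 fun {N} _ => ⟨box 0 fun _ => N, 0, _, fun _ => le_rfl, rfl⟩

theorem freq_of_tendsto {n : ℕ} {A : Set (Fin n → ℤ)} {c : ℝ}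
    (h : Tendsto (fraction A) (boxFilter n) (𝓝 c)) : FreqMeasurable A ∧ freq A = c :=
  ⟨h.liminf_eq.trans h.limsup_eq.symm, h.limsup_eq⟩

theorem box_nonempty {n : ℕ} (a : Fin n → ℤ) {ℓ : Fin n → ℕ} (h : ∀ k, 1 ≤ ℓ k) :
    (box a ℓ).Nonempty :=
  ⟨a, by simpa [box, Nat.pos_iff_ne_zero, Nat.one_le_iff_ne_zero] using h⟩

theorem eventually_nonempty (n : ℕ) : ∀ᶠ P in boxFilter n, P.Nonempty := by
  refine (boxFilter_hasBasis n).eventually_iff.2 ⟨1, trivial, ?_⟩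
  rintro P ⟨a, ℓ, h, rfl⟩
  exact box_nonempty a h

theorem card_box {n : ℕ} (a : Fin n → ℤ) (ℓ : Fin n → ℕ) : (box a ℓ).card = ∏ k, ℓ k := by
  simp [box]

/-- The average of a function over a finite set of lattice points. -/
noncomputable def average {ι : Type*} (f : ι → ℂ) (P : Finset ι) : ℂ :=
  (P.card : ℂ)⁻¹ * ∑ x ∈ P, f x

/-- A geometric sum. The bound depends neither on the position nor on the length of the interval,
which gives uniformity over all boxes. -/
theorem norm_sum_exp_le {c : ℝ} (hc : ∀ z : ℤ, c ≠ z) (a : ℤ) (ℓ : ℕ) :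
    ‖∑ t ∈ Finset.Ico a (a + ℓ), Complex.exp (2 * Real.pi * Complex.I * (c * t))‖ ≤
      2 / ‖Complex.exp (2 * Real.pi * Complex.I * c) - 1‖ := by
  set w := Complex.exp (2 * Real.pi * Complex.I * c) with hw
  have hn : ∀ s : ℝ, ‖Complex.exp (2 * Real.pi * Complex.I * s)‖ = 1 := by
    intro s
    rw [show (2 * Real.pi * Complex.I * s : ℂ) = ((2 * Real.pi * s : ℝ) : ℂ) * Complex.I by
      push_cast; ring]
    exact Complex.norm_exp_ofReal_mul_I _
  have hw1 : w - 1 ≠ 0 := by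
    intro h
    obtain ⟨z, hz⟩ := Complex.exp_eq_one_iff.1 (sub_eq_zero.1 h)
    have h2 : (2 * Real.pi * Complex.I : ℂ) ≠ 0 := by simp [Real.pi_ne_zero]
    have : (c : ℂ) = z := by
      apply mul_left_cancel₀ h2; rw [hz]; ring
    exact hc z (by exact_mod_cast this)
  have hsum : ∑ t ∈ Finset.Ico a (a + ℓ), Complex.exp (2 * Real.pi * Complex.I * (c * t)) =
      Complex.exp (2 * Real.pi * Complex.I * (c * a)) * ∑ j ∈ Finset.range ℓ, w ^ j := by
    rw [Finset.mul_sum]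
    refine (Finset.sum_bij (fun (j : ℕ) _ => a + (j : ℤ)) ?_ ?_ ?_ ?_).symm
    · intro j hj; simp at hj ⊢; omega
    · intro i _ j _ h; simpa using h
    · intro t ht
      simp only [Finset.mem_Ico] at ht
      exact ⟨(t - a).toNat, by simp; omega, by omega⟩
    · intro j _
      rw [hw, ← Complex.exp_nat_mul, ← Complex.exp_add]
      push_cast; ring_nf
  rw [hsum, norm_mul]
  have h1 := hn (c * a)
  push_cast at h1
  rw [h1, one_mul, geom_sum_eq (sub_ne_zero.1 hw1), norm_div]
  gcongr
  refine (norm_sub_le _ _).trans ?_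
  rw [norm_pow, hn c]
  norm_num

/-- Weyl's criterion for one character: its averages over growing boxes vanish. -/
theorem tendsto_average_exp {n : ℕ} {c : Fin n → ℝ} {k₀ : Fin n} (hc : ∀ z : ℤ, c k₀ ≠ z) :
    Tendsto (average fun x : Fin n → ℤ => 
        Complex.exp (2 * Real.pi * Complex.I * ∑ k, (c k * x k : ℂ)))
      (boxFilter n) (𝓝 0) := by
  set K := 2 / ‖Complex.exp (2 * Real.pi * Complex.I * c k₀) - 1‖ with hK
  have hK0 : 0 ≤ K := by positivity
  rw [Metric.tendsto_nhds]
  intro ε hε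
  obtain ⟨N, hN⟩ := exists_nat_gt (K / ε)
  refine (boxFilter_hasBasis n).eventually_iff.2 ⟨N + 1, trivial, ?_⟩
  rintro P ⟨a, ℓ, h, rfl⟩
  have hpos : ∀ k, (0 : ℝ) < ℓ k := fun k => by exact_mod_cast (Nat.succ_pos N).trans_le (h k)
  have hs : ∑ x ∈ box a ℓ, Complex.exp (2 * Real.pi * Complex.I * ∑ k, (c k * x k : ℂ)) =
      ∏ k, ∑ t ∈ Finset.Ico (a k) (a k + ℓ k), Complex.exp (2 * Real.pi * Complex.I * (c k
          * t)) := by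
    rw [Finset.prod_univ_sum]
    refine Finset.sum_congr rfl fun x _ => ?_
    rw [← Complex.exp_sum, Finset.mul_sum]
  have hn : ∀ (k : Fin n) (t : ℤ), ‖Complex.exp (2 * Real.pi * Complex.I * (c k * t))‖ = 1 := by
    intro k t
    rw [show (2 * Real.pi * Complex.I * (c k * t) : ℂ) =
      ((2 * Real.pi * (c k * t) : ℝ) : ℂ) * Complex.I by push_cast; ring]
    exact Complex.norm_exp_ofReal_mul_I _
  have hle : ∀ k, (ℓ k : ℝ)⁻¹ * ‖∑ t ∈ Finset.Ico (a k) (a k + ℓ k),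
      Complex.exp (2 * Real.pi * Complex.I * (c k * t))‖ ≤ 1 := by
    intro k
    rw [inv_mul_le_iff₀ (hpos k), mul_one]
    refine (norm_sum_le _ _).trans ?_
    simp [hn]
  rw [dist_zero_right, average, hs, card_box, norm_mul, norm_inv, Complex.norm_natCast,
    Nat.cast_prod, ← Finset.prod_inv_distrib, norm_prod, ← Finset.prod_mul_distrib,
    ← Finset.mul_prod_erase _ _ (Finset.mem_univ k₀)]
  -- The average factors over coordinates: direction `k₀` gains a factor `K / ℓ k₀`, the others are
  -- at most 1.
  calc _ ≤ (ℓ k₀ : ℝ)⁻¹ * K * 1 := by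
        gcongr
        · exact norm_sum_exp_le hc _ _
        · exact Finset.prod_le_one (fun _ _ => by positivity) fun k _ => hle k
    _ < ε := by
        have : (N : ℝ) < ℓ k₀ := by exact_mod_cast h k₀
        rw [mul_one, inv_mul_lt_iff₀ (hpos k₀)]
        rw [div_lt_iff₀ hε] at hN
        nlinarith

/-! ### Equidistribution on tori -/

/-- Averaging is 1-Lipschitz in the sup norm, uniformly in `P`; this lets limits pass from
trigonometric polynomials to their uniform closure. -/
theorem dist_average_le {ι Ω : Type*} [TopologicalSpace Ω] [CompactSpace Ω] (y : ι → Ω)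
    (P : Finset ι) (f g : C(Ω, ℂ)) :
    dist (average (fun x => f (y x)) P) (average (fun x => g (y x)) P) ≤ dist f g := by
  rw [dist_eq_norm, dist_eq_norm, average, average, ← mul_sub, ← Finset.sum_sub_distrib, norm_mul,
    norm_inv, Complex.norm_natCast]
  rcases P.eq_empty_or_nonempty with rfl | hP
  · simp
  rw [inv_mul_le_iff₀ (by exact_mod_cast hP.card_pos)]
  refine (norm_sum_le_of_le P (fun x _ => (f - g).norm_coe_le_norm (y x))).trans (by simp)

theorem continuous_integral_continuousMap {Ω : Type*} [TopologicalSpace Ω] [CompactSpace Ω]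
    [MeasurableSpace Ω] [BorelSpace Ω] (κ : Measure Ω) [IsProbabilityMeasure κ] :
    Continuous fun f : C(Ω, ℂ) => ∫ ω, f ω ∂κ := by
  refine (LipschitzWith.of_dist_le_mul (K := 1) fun f g => ?_).continuous
  have hint : ∀ g : C(Ω, ℂ), Integrable (fun ω => g ω) κ :=
    fun g => (BoundedContinuousFunction.mkOfCompact g).integrable κ
  rw [dist_eq_norm, dist_eq_norm, ← integral_sub (hint f) (hint g)]
  refine (norm_integral_le_of_norm_le_const
    (.of_forall fun ω => (f - g).norm_coe_le_norm ω)).trans (by simp)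

/-- Convergence of the averages of all monomials implies convergence of the averages of all
continuous functions. -/
theorem tendsto_average_continuousMap {ι d : Type*} [Fintype d] {F : Filter (Finset ι)}
    {y : ι → UnitAddTorus d} (κ : Measure (UnitAddTorus d)) [IsProbabilityMeasure κ]
    (h : ∀ m : d → ℤ, Tendsto (average fun x => UnitAddTorus.mFourier m (y x)) F
      (𝓝 (∫ ω, UnitAddTorus.mFourier m ω ∂κ))) (f : C(UnitAddTorus d, ℂ)) :
    Tendsto (average fun x => f (y x)) F (𝓝 (∫ ω, f ω ∂κ)) := by
  -- Equicontinuity makes the set of good functions closed; it contains the span of the monomials,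
  -- which is dense.
  have hcl : IsClosed {f : C(UnitAddTorus d, ℂ) |
      Tendsto (average fun x => f (y x)) F (𝓝 (∫ ω, f ω ∂κ))} := by
    have he : Equicontinuous fun (P : Finset ι) (f : C(UnitAddTorus d, ℂ)) =>
        average (fun x => f (y x)) P :=
      (LipschitzWith.uniformEquicontinuous (fun (P : Finset ι) (f : C(UnitAddTorus d, ℂ)) =>
        average (fun x => f (y x)) P) 1 fun P =>
        LipschitzWith.of_dist_le_mul fun f g => by
          simpa using dist_average_le y P f g).equicontinuous
    exact he.isClosed_setOfPred_tendsto (continuous_integral_continuousMap κ)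
  have hf : f ∈ closure (Submodule.span ℂ (Set.range (UnitAddTorus.mFourier (d := d))) :
      Set C(UnitAddTorus d, ℂ)) := by
    rw [← Submodule.topologicalClosure_coe, UnitAddTorus.span_mFourier_closure_eq_top]
    trivial
  refine closure_minimal ?_ hcl hf
  intro g hg
  have hint : ∀ g : C(UnitAddTorus d, ℂ), Integrable g κ :=
    fun g => (BoundedContinuousFunction.mkOfCompact g).integrable κ
  induction hg using Submodule.span_induction with
  | mem g hg => obtain ⟨m, rfl⟩ := hg; exact h m
  | zero =>
    have h0 : (average fun x => (0 : C(UnitAddTorus d, ℂ)) (y x)) = fun _ => 0 :=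
      funext fun P => by simp [average]
    rw [Set.mem_ofPred_eq, h0]
    simpa using tendsto_const_nhds
  | add f g _ _ hf hg =>
    have := Tendsto.add hf hg
    rw [← integral_add (hint f) (hint g)] at this
    refine this.congr fun P => ?_
    simp [average, Finset.sum_add_distrib, mul_add]
  | smul c f _ hf =>
    have := Tendsto.const_mul c hf
    rw [← integral_const_mul] at this
    refine this.congr fun P => ?_
    simp only [average, ContinuousMap.smul_apply, smul_eq_mul, ← Finset.mul_sum]
    ring

/-- The uniform distribution over the image of a nonempty finite set. -/
noncomputable def empirical {ι Ω : Type*} [MeasurableSpace Ω] (y : ι → Ω) (P : Finset ι) :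
    Measure Ω := (P.card : ℝ≥0∞)⁻¹ • ∑ x ∈ P, Measure.dirac (y x)

theorem isProbabilityMeasure_empirical {ι Ω : Type*} [MeasurableSpace Ω] (y : ι → Ω)
    {P : Finset ι} (hP : P.Nonempty) : IsProbabilityMeasure (empirical y P) := by
  constructor
  simp only [empirical, Measure.smul_apply, Measure.coe_finsetSum, Finset.sum_apply,
    Measure.dirac_apply_of_mem (Set.mem_univ _), smul_eq_mul, Finset.sum_const, nsmul_eq_mul,
        mul_one]
  exact ENNReal.inv_mul_cancel (by simpa using hP.ne_empty) (by simp)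

theorem empirical_toReal {n : ℕ} {Ω : Type*} [MeasurableSpace Ω] [MeasurableSingletonClass Ω]
    (y : (Fin n → ℤ) → Ω) (P : Finset (Fin n → ℤ)) (A : Set Ω) :
    (empirical y P A).toReal = fraction (y ⁻¹' A) P := by
  classical
  simp only [empirical, Measure.smul_apply, Measure.coe_finsetSum, Finset.sum_apply,
    Measure.dirac_apply, smul_eq_mul, ENNReal.toReal_mul, ENNReal.toReal_inv,
    ENNReal.toReal_natCast, fraction, div_eq_inv_mul]
  congr 1
  rw [ENNReal.toReal_sum fun x _ => by by_cases h : y x ∈ A <;> simp [h], Finset.card_filter]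
  push_cast
  refine Finset.sum_congr rfl fun x _ => ?_
  by_cases h : y x ∈ A <;> simp [h]

theorem integral_empirical {ι Ω : Type*} [MeasurableSpace Ω] [MeasurableSingletonClass Ω]
    (y : ι → Ω) (P : Finset ι) (f : Ω → ℂ) :
    ∫ ω, f ω ∂(empirical y P) = average (fun x => f (y x)) P := by
  rw [empirical, integral_smul_measure, integral_finsetSum_measure]
  · simp [average]
  · intro x _
    exact integrable_dirac (by simp)

/-- Equidistribution of a lattice map on a torus with respect to `κ`, tested on sets with
`κ`-null boundary. -/
theorem tendsto_fraction_of_mFourier {n : ℕ} {d : Type*} [Fintype d]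
    {y : (Fin n → ℤ) → UnitAddTorus d} (κ : Measure (UnitAddTorus d)) [IsProbabilityMeasure κ]
    (h : ∀ m : d → ℤ, Tendsto (average fun x => UnitAddTorus.mFourier m (y x)) (boxFilter n)
      (𝓝 (∫ ω, UnitAddTorus.mFourier m ω ∂κ))) {A : Set (UnitAddTorus d)}
    (hA : κ (frontier A) = 0) :
    Tendsto (fraction (y ⁻¹' A)) (boxFilter n) (𝓝 (κ.real A)) := by
  classical
  -- The Dirac mass is a dummy value for empty `P`, which eventually does not occur.
  let ν : Finset (Fin n → ℤ) → ProbabilityMeasure (UnitAddTorus d) := fun P =>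
    if hP : P.Nonempty then ⟨empirical y P, isProbabilityMeasure_empirical y hP⟩
    else ⟨Measure.dirac (y 0), inferInstance⟩
  have hν : ∀ᶠ P in boxFilter n, (ν P : Measure (UnitAddTorus d)) = empirical y P := by
    filter_upwards [eventually_nonempty n] with P hP
    simp [ν, hP]
  let κ' : ProbabilityMeasure (UnitAddTorus d) := ⟨κ, inferInstance⟩
  have hlim : Tendsto ν (boxFilter n) (𝓝 κ') := by
    rw [ProbabilityMeasure.tendsto_iff_forall_integral_rclike_tendsto ℂ]
    intro f
    refine (tendsto_average_continuousMap κ h f.toContinuousMap).congr' ?_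
    filter_upwards [hν] with P hP
    rw [hP, integral_empirical]
    rfl
  have := ProbabilityMeasure.tendsto_measure_of_null_frontier_of_tendsto' hlim (E := A) hA
  refine ((ENNReal.tendsto_toReal (measure_ne_top κ A)).comp this).congr' ?_
  filter_upwards [hν] with P hP
  simp only [Function.comp_apply]
  rw [hP, empirical_toReal]

section Cell

/-! ### The cell of a quantizer -/

/-- Sets such as the cell are not assumed Borel; a null boundary is what makes them measurable up to
null sets. -/
theorem nullMeasurableSet_of_null_frontier {X : Type*} [TopologicalSpace X] [MeasurableSpace X]
    [OpensMeasurableSpace X] {μ : Measure X} {s : Set X} (h : μ (frontier s) = 0) :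
    NullMeasurableSet s μ := by
  have hs : s =ᵐ[μ] closure s :=
    subset_closure.eventuallyLE.antisymm
      (ae_le_set.2 (measure_mono_null (Set.sdiff_subset_sdiff_right interior_subset) h))
  exact isClosed_closure.measurableSet.nullMeasurableSet.congr hs.symm

variable {n : ℕ} {R : (Fin n → ℝ) → (Fin n → ℤ)}

theorem sub_toReal_mem_cell (hR : ∀ u z, R (u + toReal z) = R u + z) (u : Fin n → ℝ) :
    u - toReal (R u) ∈ cell R := by
  have h : u - toReal (R u) = u + toReal (-R u) := by ext i; simp [toReal, sub_eq_add_neg]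
  simp [cell, h, hR]

theorem eq_of_mem_cell (hR : ∀ u z, R (u + toReal z) = R u + z) {u v : Fin n → ℝ}
    (hu : u ∈ cell R) (hv : v ∈ cell R) {z : Fin n → ℤ} (h : u = v + toReal z) : u = v := by
  have hz : z = 0 := by
    have := hR v z
    rw [← h, show R u = 0 from hu, show R v = 0 from hv, zero_add] at this
    exact this.symm
  rw [h, hz]
  ext i; simp [toReal]

/-- The only lattice translate of `x` lying in the cell is `x - R x`. -/
theorem isAddFundamentalDomain_cell (hR : ∀ u z, R (u + toReal z) = R u + z)
    (hm : NullMeasurableSet (cell R)) :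
    IsAddFundamentalDomain (Submodule.span ℤ (Set.range (Pi.basisFun ℝ (Fin n)))) (cell R) := by
  have hmem : ∀ z : Fin n → ℤ, toReal z ∈ Submodule.span ℤ (Set.range (Pi.basisFun ℝ (Fin n))) := by
    intro z
    refine (Submodule.mem_span_range_iff_exists_fun ℤ).2 ⟨z, ?_⟩
    ext i
    simp [toReal, Pi.single_apply]
  have hex : ∀ g ∈ Submodule.span ℤ (Set.range (Pi.basisFun ℝ (Fin n))), ∃ z, g = toReal z := by
    intro g hg
    obtain ⟨z, rfl⟩ := (Submodule.mem_span_range_iff_exists_fun ℤ).1 hg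
    refine ⟨z, ?_⟩
    ext i
    simp [toReal, Pi.single_apply]
  refine IsAddFundamentalDomain.mk' hm fun x => ⟨⟨toReal (-R x), hmem _⟩, ?_, ?_⟩
  · change toReal (-R x) + x ∈ cell R
    convert sub_toReal_mem_cell hR x using 1
    ext i; simp [toReal]; ring
  · rintro ⟨g, hg⟩ hgx
    obtain ⟨z, rfl⟩ := hex g hg
    change toReal z + x ∈ cell R at hgx
    rw [Subtype.mk.injEq]
    congr 1
    rw [add_comm, cell, Set.mem_preimage, hR, Set.mem_singleton_iff] at hgx
    exact eq_neg_of_add_eq_zero_right hgx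

theorem IsQuantizer.nullMeasurableSet_cell (hR : IsQuantizer R) : NullMeasurableSet (cell R) :=
  nullMeasurableSet_of_null_frontier hR.jordan.2

theorem IsQuantizer.volume_cell (hR : IsQuantizer R) : volume (cell R) = 1 := by
  have h := isAddFundamentalDomain_cell hR.map_add hR.nullMeasurableSet_cell
  have h' := ZSpan.isAddFundamentalDomain (Pi.basisFun ℝ (Fin n)) volume
  have : VAddInvariantMeasure (Submodule.span ℤ (Set.range (Pi.basisFun ℝ (Fin n))))
    (Fin n → ℝ) volume := inferInstanceAs <| VAddInvariantMeasure
      (Submodule.span ℤ (Set.range (Pi.basisFun ℝ (Fin n)))).toAddSubgroup (Fin n → ℝ) volume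
  rw [h.measure_eq h', ZSpan.fundamentalDomain_pi_basisFun, volume_pi, Measure.pi_pi]
  simp

theorem IsQuantizer.isProbabilityMeasure (hR : IsQuantizer R) :
    IsProbabilityMeasure (volume.restrict (cell R)) :=
  ⟨by rw [Measure.restrict_apply_univ, hR.volume_cell]⟩

/-- Nonconstant characters have zero mean over the cell. -/
theorem IsQuantizer.integral_exp_cell (hR : IsQuantizer R) {m : Fin n → ℤ} (hm : m ≠ 0) :
    ∫ u in cell R, Complex.exp (2 * Real.pi * Complex.I * ∑ i, (m i * u i : ℂ)) = 0 := by
  obtain ⟨i₀, hi₀⟩ := Function.ne_iff.1 hm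
  set f : (Fin n → ℝ) → ℂ := fun u => Complex.exp (2 * Real.pi * Complex.I * ∑ i, (m i * u i : ℂ))
    with hf
  -- A shift by half a period reverses the sign of the character. The shifted cell is again a
  -- fundamental domain, so the integral equals its own negative.
  set s : Fin n → ℝ := Pi.single i₀ (1 / (2 * m i₀)) with hs
  have hfs : ∀ u, f (u + s) = - f u := by
    intro u
    have h1 : ∑ i, (m i * ((u + s) i : ℝ) : ℂ) = ∑ i, (m i * u i : ℂ) + 1 / 2 := by
      simp only [Pi.add_apply, Complex.ofReal_add, mul_add, Finset.sum_add_distrib]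
      congr 1
      rw [Finset.sum_eq_single i₀]
      · have : (m i₀ : ℂ) ≠ 0 := by exact_mod_cast hi₀
        simp [hs]; field_simp
      · intro j _ hj; simp [hs, hj]
      · simp
    simp only [hf]
    rw [h1, mul_add, Complex.exp_add,
      show (2 * Real.pi * Complex.I * (1 / 2) : ℂ) = Real.pi * Complex.I by ring,
      Complex.exp_pi_mul_I]
    ring
  have hfper : ∀ (g : Submodule.span ℤ (Set.range (Pi.basisFun ℝ (Fin n)))) (u : Fin n → ℝ),
      f (g +ᵥ u) = f u := by
    rintro ⟨g, hg⟩ u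
    obtain ⟨z, rfl⟩ := (Submodule.mem_span_range_iff_exists_fun ℤ).1 hg
    simp only [hf]
    refine Complex.exp_eq_exp_iff_exists_int.2 ⟨∑ i, m i * z i, ?_⟩
    have : ∀ i, ((⟨_, hg⟩ : Submodule.span ℤ (Set.range (Pi.basisFun ℝ (Fin n)))) +ᵥ u) i
        = z i + u i := by
      intro i
      change (∑ j, z j • (Pi.basisFun ℝ (Fin n)) j + u) i = _
      simp [Pi.single_apply]
    simp only [this]
    push_cast
    simp only [mul_add, Finset.sum_add_distrib]
    ring
  have h := isAddFundamentalDomain_cell hR.map_add hR.nullMeasurableSet_cell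
  have : VAddInvariantMeasure (Submodule.span ℤ (Set.range (Pi.basisFun ℝ (Fin n))))
    (Fin n → ℝ) volume := inferInstanceAs <| VAddInvariantMeasure
      (Submodule.span ℤ (Set.range (Pi.basisFun ℝ (Fin n)))).toAddSubgroup (Fin n → ℝ) volume
  have hpre : (fun u => u + s) ⁻¹' (cell fun u => R (u - s)) = cell R := by
    ext u; simp [cell]
  have hadd : ∀ (u : Fin n → ℝ) (z : Fin n → ℤ), R (u + toReal z - s) = R (u - s) + z := by
    intro u z; rw [← hR.map_add]; congr 1; abel
  have h' : IsAddFundamentalDomain _ _ _ := isAddFundamentalDomain_cell (R := fun u => R (u - s))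
      hadd (by
    have := hR.nullMeasurableSet_cell.preimage
      (measurePreserving_sub_right volume s).quasiMeasurePreserving
    exact this)
  have key := (measurePreserving_add_right (volume : Measure (Fin n → ℝ))
      s).setIntegral_preimage_emb
    (measurableEmbedding_addRight s) f (cell fun u => R (u - s))
  rw [hpre, h'.setIntegral_eq h hfper] at key
  simp only [hfs, integral_neg] at key
  exact self_eq_neg.1 key.symm

end Cell

section Errors

/-! ### Quantization errors -/

variable {n : ℕ} {R : (Fin n → ℝ) → (Fin n → ℤ)} {L : Matrix (Fin n) (Fin n) ℝ} {N : ℕ}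

/-- The first `N` quantization errors along a trajectory of the quantized system. -/
def errors (R : (Fin n → ℝ) → (Fin n → ℤ)) (L : Matrix (Fin n) (Fin n) ℝ) (N : ℕ)
    (x : Fin n → ℤ) : Fin N → Fin n → ℝ :=
  fun k => L *ᵥ toReal ((transition R L)^[k] x) - toReal ((transition R L)^[k + 1] x)

theorem errors_mem_cell (hR : ∀ u z, R (u + toReal z) = R u + z) (x : Fin n → ℤ) (k : Fin N) :
    errors R L N x k ∈ cell R := by
  rw [errors, Function.iterate_succ_apply']
  exact sub_toReal_mem_cell hR _

/-- The unipotent linear map `e ↦ (∑_{j ≤ k} L^(k-j) e_j)_k`. -/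
noncomputable def shear (L : Matrix (Fin n) (Fin n) ℝ) (N : ℕ) :
    (Fin N → Fin n → ℝ) →ₗ[ℝ] (Fin N → Fin n → ℝ) :=
  LinearMap.pi fun k => LinearMap.proj k +
    ∑ j ∈ Finset.Iio k, (L ^ ((k : ℕ) - j)).mulVecLin ∘ₗ LinearMap.proj j

theorem shear_apply (e : Fin N → Fin n → ℝ) (k : Fin N) :
    shear L N e k = e k + ∑ j ∈ Finset.Iio k, L ^ ((k : ℕ) - j) *ᵥ e j := by
  simp [shear]

theorem sum_Iio_fin {M : Type*} [AddCommMonoid M] (f : ℕ → M) (k : Fin N) :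
    ∑ j ∈ Finset.Iio k, f j = ∑ j ∈ Finset.range k, f j := by
  rw [← Nat.Iio_eq_range, ← Fin.map_valEmbedding_Iio, Finset.sum_map]
  rfl

/-- The sum telescopes. Modulo the lattice only `L^(k+1) x` is left, which is linear in `x` although
the errors are not. -/
theorem shear_errors (x : Fin n → ℤ) (k : Fin N) :
    shear L N (errors R L N x) k =
      L ^ ((k : ℕ) + 1) *ᵥ toReal x - toReal ((transition R L)^[k + 1] x) := by
  rw [shear_apply]
  have h := sum_Iio_fin (fun j => L ^ ((k : ℕ) - j) *ᵥ
    (L *ᵥ toReal ((transition R L)^[j] x) - toReal ((transition R L)^[j + 1] x))) k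
  have h2 : ∀ j ∈ Finset.range k, L ^ ((k : ℕ) - j) *ᵥ
      (L *ᵥ toReal ((transition R L)^[j] x) - toReal ((transition R L)^[j + 1] x)) =
      L ^ ((k : ℕ) + 1 - j) *ᵥ toReal ((transition R L)^[j] x) -
        L ^ ((k : ℕ) + 1 - (j + 1)) *ᵥ toReal ((transition R L)^[j + 1] x) := by
    intro j hj
    have := Finset.mem_range.1 hj
    rw [Matrix.mulVec_sub, Matrix.mulVec_mulVec, ← pow_succ]
    rw [show (k : ℕ) - j + 1 = k + 1 - j by omega, show (k : ℕ) + 1 - (j + 1) = k - j by omega]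
  rw [Finset.sum_congr rfl h2,
    Finset.sum_range_sub' (fun j => L ^ ((k : ℕ) + 1 - j) *ᵥ toReal ((transition R L)^[j] x))] at h
  simp only [errors]
  rw [h, add_tsub_cancel_left, pow_one]
  simp

theorem shear_injective : Function.Injective (shear L N) := by
  rw [← LinearMap.ker_eq_bot, LinearMap.ker_eq_bot']
  intro e he
  funext k
  induction k using Fin.strong_induction_on with
  | h k ih =>
    have h := congrFun he k
    rw [shear_apply, Finset.sum_eq_zero fun j hj => by
      rw [ih j (Finset.mem_Iio.1 hj)]; exact Matrix.mulVec_zero _, add_zero] at h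
    exact h

theorem shear_surjective : Function.Surjective (shear L N) :=
  LinearMap.injective_iff_surjective.1 shear_injective

/-- A triangular system of equations has a solution. -/
theorem exists_triangular_solution {X : Type*} [Inhabited X] (G : Fin N → (Fin N → X) → X)
    (hG : ∀ k e e', (∀ j < k, e j = e' j) → G k e = G k e') : ∃ e, ∀ k, e k = G k e := by
  suffices h : ∀ m : ℕ, ∃ e : Fin N → X, ∀ k : Fin N, (k : ℕ) < m → e k = G k e by
    obtain ⟨e, he⟩ := h N
    exact ⟨e, fun k => he k k.2⟩
  intro m
  induction m with
  | zero => exact ⟨fun _ => default, fun k hk => absurd hk (Nat.not_lt_zero _)⟩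
  | succ m ih =>
    obtain ⟨e, he⟩ := ih
    by_cases hm : m < N
    · refine ⟨Function.update e ⟨m, hm⟩ (G ⟨m, hm⟩ e), fun k hk => ?_⟩
      have hlt : ∀ j : Fin N, j < k → Function.update e ⟨m, hm⟩ (G ⟨m, hm⟩ e) j = e j := by
        intro j hj
        refine Function.update_of_ne (fun h => ?_) _ _
        have h1 : (j : ℕ) = m := by rw [h]
        have h2 : (j : ℕ) < k := hj
        omega
      rw [hG k _ e hlt]
      rcases (Nat.lt_succ_iff.1 hk).lt_or_eq with h | h
      · rw [Function.update_of_ne, he k h]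
        rintro rfl
        exact h.ne rfl
      · obtain rfl : k = ⟨m, hm⟩ := Fin.ext h
        simp
    · exact ⟨e, fun k _ => he k (k.2.trans_le (not_lt.1 hm))⟩

/-- The map `e ↦ (∑_{j ≤ k} L^(k-j) e_j)_k` modulo the integer lattice. -/
noncomputable def shearTorus (L : Matrix (Fin n) (Fin n) ℝ) (N : ℕ) (e : Fin N → Fin n → ℝ) :
    UnitAddTorus (Fin N × Fin n) :=
  fun p => (shear L N e p.1 p.2 : UnitAddCircle)

theorem shearTorus_eq_iff {e e' : Fin N → Fin n → ℝ} :
    shearTorus L N e = shearTorus L N e' ↔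
      ∃ z : Fin N → Fin n → ℤ, shear L N e = shear L N e' + fun k => toReal (z k) := by
  constructor
  · intro h
    have h1 : ∀ k i, ∃ z : ℤ, shear L N e k i = shear L N e' k i + z := by
      intro k i
      have := congrFun h (k, i)
      rw [shearTorus, shearTorus, ← sub_eq_zero, ← AddCircle.coe_sub,
        AddCircle.coe_eq_zero_iff] at this
      obtain ⟨z, hz⟩ := this
      exact ⟨z, by simp at hz; linarith⟩
    choose z hz using h1
    exact ⟨z, funext fun k => funext fun i => hz k i⟩
  · rintro ⟨z, hz⟩
    funext p
    simp only [shearTorus, hz, Pi.add_apply, toReal]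
    simp

theorem continuous_shearTorus : Continuous (shearTorus L N) := by
  have : Continuous (shear L N) := (shear L N).continuous_of_finiteDimensional
  refine continuous_pi fun p => ?_
  exact (AddCircle.continuous_mk' 1).comp ((continuous_apply p.2).comp ((continuous_apply
      p.1).comp this))

theorem isOpenMap_shearTorus : IsOpenMap (shearTorus L N) := by
  have h1 : IsOpenMap ((LinearEquiv.curry ℝ ℝ (Fin N) (Fin n)).symm.toLinearMap ∘ₗ shear L N) :=
    LinearMap.isOpenMap_of_finiteDimensional _
      ((LinearEquiv.curry ℝ ℝ (Fin N) (Fin n)).symm.surjective.comp shear_surjective)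
  have h2 : IsOpenMap (Pi.map fun (_ : Fin N × Fin n) (t : ℝ) => (t : UnitAddCircle)) :=
    IsOpenMap.piMap (fun _ => QuotientAddGroup.isOpenMap_coe)
      (.of_forall fun _ => QuotientAddGroup.mk_surjective)
  exact h2.comp h1

/-- If the components before `k` agree, equality on the torus forces the `k`th ones to differ by a
lattice vector, and the cell contains one representative per class. -/
theorem shearTorus_injOn (hR : ∀ u z, R (u + toReal z) = R u + z) :
    Set.InjOn (shearTorus L N) (Set.univ.pi fun _ => cell R) := by
  intro e he e' he' h
  obtain ⟨z, hz⟩ := shearTorus_eq_iff.1 h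
  funext k
  induction k using Fin.strong_induction_on with
  | h k ih =>
    refine eq_of_mem_cell hR (he k trivial) (he' k trivial) (z := z k) ?_
    have h := congrFun hz k
    rw [Pi.add_apply, shear_apply, shear_apply, Finset.sum_congr rfl fun j hj => by
      rw [ih j (Finset.mem_Iio.1 hj)]] at h
    rw [add_right_comm] at h
    exact add_right_cancel h

theorem shearTorus_surjOn (hR : ∀ u z, R (u + toReal z) = R u + z) (y : UnitAddTorus (Fin N × Fin
    n)) :
    ∃ e ∈ Set.univ.pi fun _ => cell R, shearTorus L N e = y := by
  choose w hw using fun p => QuotientAddGroup.mk_surjective (y p)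
  let v : (Fin N → Fin n → ℝ) → Fin N → Fin n → ℝ := fun e k =>
    (fun i => w (k, i)) - ∑ j ∈ Finset.Iio k, L ^ ((k : ℕ) - j) *ᵥ e j
  -- The `k`th component is what earlier components leave of the target, reduced into the cell by
  -- subtracting its quantized value.
  obtain ⟨e, he⟩ := exists_triangular_solution (fun k e => v e k - toReal (R (v e k))) (by
    intro k e e' h
    have : v e k = v e' k := by
      simp only [v]
      rw [Finset.sum_congr rfl fun j hj => by rw [h j (Finset.mem_Iio.1 hj)]]
    simp only [this])
  refine ⟨e, fun k _ => by rw [he k]; exact sub_toReal_mem_cell hR _, ?_⟩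
  funext p
  obtain ⟨k, i⟩ := p
  have h : shear L N e k i = w (k, i) - R (v e k) i := by
    rw [shear_apply, he k]
    simp [v, toReal]
    ring
  rw [← hw, shearTorus, h]
  simp

end Errors

/-! ### Joint distribution of the errors -/

section ErrorFrequencies

variable {n : ℕ} {R : (Fin n → ℝ) → (Fin n → ℤ)} {L : Matrix (Fin n) (Fin n) ℝ} {N : ℕ}

/-- The joint distribution of `N` independent vectors, uniform over the cell. -/
noncomputable def cellPi (R : (Fin n → ℝ) → (Fin n → ℤ)) (N : ℕ) : Measure (Fin N → Fin n → ℝ) :=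
  Measure.pi fun _ => volume.restrict (cell R)

theorem IsQuantizer.isProbabilityMeasure_cellPi (hR : IsQuantizer R) :
    IsProbabilityMeasure (cellPi R N) := by
  have := hR.isProbabilityMeasure
  rw [cellPi]
  infer_instance

theorem cellPi_eq_restrict :
    cellPi R N = (volume : Measure (Fin N → Fin n → ℝ)).restrict (Set.univ.pi fun _ => cell R) := by
  rw [cellPi, ← Measure.restrict_pi_pi]
  rfl

theorem IsQuantizer.ae_mem_cell (hR : IsQuantizer R) :
    ∀ᵐ e ∂(cellPi R N), e ∈ Set.univ.pi fun _ => cell R := by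
  have := hR.isProbabilityMeasure
  have h : ∀ k : Fin N, ∀ᵐ e ∂(cellPi R N), e k ∈ cell R := fun k =>
    (Measure.quasiMeasurePreserving_eval (fun _ => volume.restrict (cell R))
        k).tendsto_ae.eventually
      (ae_restrict_mem₀ hR.nullMeasurableSet_cell)
  filter_upwards [ae_all_iff.2 h] with e he k _ using he k

/-- The push-forward of a volume-null compact set is null. -/
theorem shearTorus_image_null {K : Set (Fin N → Fin n → ℝ)} (hK : volume K = 0) :
    cellPi R N (shearTorus L N ⁻¹' (shearTorus L N '' K)) = 0 := by
  choose w hw using fun z : Fin N → Fin n → ℤ => shear_surjective (L := L) (fun k => toReal (z k))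
  -- The fibres of the torus map are translates of a countable group, so countably many translates
  -- of `K` suffice.
  have hsub : shearTorus L N ⁻¹' (shearTorus L N '' K) ⊆ ⋃ z, (fun e => e - w z) ⁻¹' K := by
    rintro e ⟨e', he', h⟩
    obtain ⟨z, hz⟩ := shearTorus_eq_iff.1 h.symm
    refine Set.mem_iUnion.2 ⟨z, ?_⟩
    rw [← hw, ← map_add] at hz
    rw [Set.mem_preimage, shear_injective hz, add_sub_cancel_right]
    exact he'
  rw [cellPi_eq_restrict]
  refine measure_mono_null hsub (Measure.restrict_le_self.absolutelyContinuous ?_)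
  refine measure_iUnion_null fun z => ?_
  rw [(measurePreserving_sub_right (volume : Measure (Fin N → Fin n → ℝ)) (w
      z)).measure_preimage_emb
    (measurableEmbedding_subRight _), hK]

theorem volume_pi_closure_diff_interior {s : Set (Fin n → ℝ)} (h : volume (frontier s) = 0) :
    volume ((Set.univ.pi fun _ : Fin N => closure s) \ Set.univ.pi fun _ : Fin N => interior s) =
        0 := by
  refine measure_mono_null (t := ⋃ k : Fin N, (fun e => e k) ⁻¹' frontier s) ?_
    (measure_iUnion_null fun k => ?_)
  · rintro e ⟨h1, h2⟩
    simp only [Set.mem_pi, Set.mem_univ, true_imp_iff, not_forall] at h1 h2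
    obtain ⟨k, hk⟩ := h2
    exact Set.mem_iUnion.2 ⟨k, h1 k, hk⟩
  · exact (Measure.quasiMeasurePreserving_eval (fun _ : Fin N => (volume : Measure (Fin n → ℝ)))
      k).preimage_null h

theorem isCompact_pi_closure_cell (hR : IsQuantizer R) :
    IsCompact (Set.univ.pi fun _ : Fin N => closure (cell R)) :=
  isCompact_univ_pi fun _ => hR.jordan.1.isCompact_closure

/-- The image on the torus of a set of error vectors with null boundary has null boundary. -/
theorem map_shearTorus_frontier_null (hR : IsQuantizer R) {C : Set (Fin N → Fin n → ℝ)}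
    (hC : cellPi R N (frontier C) = 0) :
    (cellPi R N).map (shearTorus L N)
      (frontier (shearTorus L N '' (C ∩ Set.univ.pi fun _ => cell R))) = 0 := by
  set Q : Set (Fin N → Fin n → ℝ) := Set.univ.pi fun _ => cell R with hQ
  set Qc : Set (Fin N → Fin n → ℝ) := Set.univ.pi fun _ => closure (cell R) with hQc
  set Qi : Set (Fin N → Fin n → ℝ) := Set.univ.pi fun _ => interior (cell R) with hQi
  have hQio : IsOpen Qi := isOpen_set_pi Set.finite_univ fun _ _ => isOpen_interior
  have hQiQ : Qi ⊆ Q := Set.pi_mono fun _ _ => interior_subset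
  have hQQc : Q ⊆ Qc := Set.pi_mono fun _ _ => subset_closure
  have hd := volume_pi_closure_diff_interior (N := N) hR.jordan.2
  -- `K` collects the points of the closed product at the boundary of `C` or outside the interior
  -- product. It is compact and null, and its image will contain the boundary of the image.
  set K := frontier C ∩ Qc ∪ Qc \ Qi with hK
  have hKc : IsCompact K :=
    ((isCompact_pi_closure_cell hR).inter_left isClosed_frontier).union
      ((isCompact_pi_closure_cell hR).diff hQio)
  have hK0 : volume K = 0 := by
    rw [cellPi_eq_restrict, Measure.restrict_apply isClosed_frontier.measurableSet] at hC
    refine measure_mono_null (t := frontier C ∩ Q ∪ Qc \ Qi) ?_ (measure_union_null hC hd)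
    rintro e (⟨h1, h2⟩ | h)
    · by_cases he : e ∈ Qi
      · exact Or.inl ⟨h1, hQiQ he⟩
      · exact Or.inr ⟨h2, he⟩
    · exact Or.inr h
  have hsub : frontier (shearTorus L N '' (C ∩ Q)) ⊆ shearTorus L N '' K := by
    intro y hy
    obtain ⟨e, he, rfl⟩ := shearTorus_surjOn (L := L) hR.map_add y
    by_contra hcon
    have heK : e ∉ K := fun h => hcon ⟨e, h, rfl⟩
    have hei : e ∈ Qi := by
      by_contra h
      exact heK (Or.inr ⟨hQQc he, h⟩)
    have hef : e ∉ frontier C := fun h => heK (Or.inl ⟨h, hQQc he⟩)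
    by_cases hint : e ∈ interior C
    -- Openness of the torus map makes the image point interior.
    · refine hy.2 (mem_interior.2 ⟨shearTorus L N '' (interior C ∩ Qi), ?_, ?_, ?_⟩)
      · exact Set.image_mono (Set.inter_subset_inter interior_subset hQiQ)
      · exact isOpenMap_shearTorus _ (isOpen_interior.inter hQio)
      · exact ⟨e, ⟨hint, hei⟩, rfl⟩
    · have hext : e ∈ interior Cᶜ := by
        rw [interior_compl]
        exact fun h => hef ⟨h, hint⟩
      -- Injectivity on the product of cells separates the images; the first is open, so it also
      -- misses the closure of the second.
      have hdis : Disjoint (shearTorus L N '' (interior Cᶜ ∩ Qi)) (shearTorus L N '' (C ∩ Q)) := by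
        rw [Set.disjoint_left]
        rintro _ ⟨a, ⟨ha, haQ⟩, rfl⟩ ⟨b, ⟨hb, hbQ⟩, hab⟩
        rw [shearTorus_injOn hR.map_add hbQ (hQiQ haQ) hab] at hb
        exact interior_subset ha hb
      have hdis' := hdis.closure_right (isOpenMap_shearTorus _ (isOpen_interior.inter hQio))
      exact Set.disjoint_left.1 hdis' ⟨e, ⟨hext, hei⟩, rfl⟩ hy.1
  refine measure_mono_null hsub ?_
  rw [Measure.map_apply continuous_shearTorus.measurable
    (hKc.image continuous_shearTorus).isClosed.measurableSet]
  exact shearTorus_image_null hK0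

/-- The measure is carried by the product of cells, where the torus map is injective, so taking the
image and then the preimage changes `C` by a null set only. -/
theorem map_shearTorus_image (hR : IsQuantizer R) {C : Set (Fin N → Fin n → ℝ)}
    (hC : cellPi R N (frontier C) = 0) :
    (cellPi R N).map (shearTorus L N) (shearTorus L N '' (C ∩ Set.univ.pi fun _ => cell R)) =
      cellPi R N C := by
  rw [Measure.map_apply₀ continuous_shearTorus.aemeasurable
    (nullMeasurableSet_of_null_frontier (map_shearTorus_frontier_null hR hC))]
  refine measure_congr ?_
  filter_upwards [hR.ae_mem_cell (N := N)] with e he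
  refine propext ⟨?_, fun h => ⟨e, ⟨h, he⟩, rfl⟩⟩
  rintro ⟨e', ⟨h1, h2⟩, h3⟩
  rw [← shearTorus_injOn hR.map_add h2 he h3]
  exact h1

/-! ### Fourier coefficients -/

theorem mFourier_coe {d : Type*} [Fintype d] (m : d → ℤ) (v : d → ℝ) :
    UnitAddTorus.mFourier m (fun p => (v p : UnitAddCircle)) =
      Complex.exp (2 * Real.pi * Complex.I * ∑ p, (m p * v p : ℂ)) := by
  simp only [UnitAddTorus.mFourier, ContinuousMap.coe_mk]
  rw [Finset.mul_sum, Complex.exp_sum]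
  refine Finset.prod_congr rfl fun p _ => ?_
  rw [fourier_coe_apply]
  congr 1
  push_cast
  ring

/-- The composed character is a product over the independent components. In the last block `k₀`
where `m` is nonzero, the component `e_{k₀}` appears with integer coefficients only, because the
later blocks that mix it through powers of `L` carry zero weight. That factor integrates to zero
over the cell. -/
theorem integral_mFourier_shearTorus (hR : IsQuantizer R) {m : Fin N × Fin n → ℤ} (hm : m ≠ 0) :
    ∫ y, UnitAddTorus.mFourier m y ∂((cellPi R N).map (shearTorus L N)) = 0 := by
  classical
  have := hR.isProbabilityMeasure
  rw [integral_map continuous_shearTorus.aemeasurable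
    (UnitAddTorus.mFourier m).continuous.aestronglyMeasurable]
  let ℓ : (Fin N → Fin n → ℝ) → ℝ := fun e => ∑ p : Fin N × Fin n, m p * shear L N e p.1 p.2
  have hℓ : ∀ e, ℓ e = ∑ j, ℓ (Pi.single j (e j)) := by
    intro e
    simp only [ℓ]
    rw [Finset.sum_comm]
    refine Finset.sum_congr rfl fun p _ => ?_
    rw [← Finset.mul_sum]
    congr 1
    conv_lhs => rw [← Finset.univ_sum_single e, map_sum]
    simp
  have hexp : ∀ e, UnitAddTorus.mFourier m (shearTorus L N e) =
      ∏ j, Complex.exp (2 * Real.pi * Complex.I * ℓ (Pi.single j (e j))) := by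
    intro e
    rw [← Complex.exp_sum, ← Finset.mul_sum, ← Complex.ofReal_sum, ← hℓ]
    refine (mFourier_coe m fun p => shear L N e p.1 p.2).trans ?_
    simp [ℓ]
  simp only [hexp]
  rw [cellPi, integral_fintype_prod_eq_prod (fun j (u : Fin n → ℝ) =>
    Complex.exp (2 * Real.pi * Complex.I * ℓ (Pi.single j u)))]
  obtain ⟨k₀, hk₀, hmax⟩ : ∃ k₀ : Fin N, (fun i => m (k₀, i)) ≠ 0 ∧ ∀ k, k₀ < k → ∀ i, m (k, i) =
      0 := by
    have hne : (Finset.univ.filter fun k : Fin N => (fun i => m (k, i)) ≠ 0).Nonempty := by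
      by_contra h
      rw [Finset.not_nonempty_iff_eq_empty, Finset.filter_eq_empty_iff] at h
      refine hm (funext fun p => ?_)
      have := not_not.1 (h (Finset.mem_univ p.1))
      exact congrFun this p.2
    refine ⟨Finset.max' _ hne, (Finset.mem_filter.1 (Finset.max'_mem _ hne)).2, fun k hk i => ?_⟩
    by_contra h
    refine absurd (Finset.le_max' _ k (Finset.mem_filter.2 ⟨Finset.mem_univ k, fun h0 => ?_⟩))
        hk.not_ge
    exact h (congrFun h0 i)
  refine Finset.prod_eq_zero (Finset.mem_univ k₀) ?_
  rw [← hR.integral_exp_cell hk₀]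
  refine integral_congr_ae (.of_forall fun u => ?_)
  simp only
  congr 2
  have hsingle : ∀ k ≤ k₀, shear L N (Pi.single k₀ u) k = (Pi.single k₀ u : Fin N → Fin n →
      ℝ) k := by
    intro k hk
    rw [shear_apply, Finset.sum_eq_zero, add_zero]
    intro j hj
    rw [Pi.single_eq_of_ne ((Finset.mem_Iio.1 hj).trans_le hk).ne, Matrix.mulVec_zero]
  simp only [ℓ]
  rw [Fintype.sum_prod_type, Finset.sum_eq_single k₀]
  · simp [hsingle k₀ le_rfl]
  · intro k _ hk
    refine Finset.sum_eq_zero fun i _ => ?_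
    rcases lt_or_gt_of_ne hk with h | h
    · rw [hsingle k h.le, Pi.single_eq_of_ne hk]; simp
    · rw [hmax k h i]; simp
  · simp

theorem mFourier_shearTorus_errors (m : Fin N × Fin n → ℤ) (x : Fin n → ℤ) :
    UnitAddTorus.mFourier m (shearTorus L N (errors R L N x)) =
      Complex.exp (2 * Real.pi * Complex.I * ∑ j,
        (((∑ p, m p * (L ^ ((p.1 : ℕ) + 1)) p.2 j : ℝ) : ℂ) * x j)) := by
  have h : shearTorus L N (errors R L N x) =
      fun p => (((L ^ ((p.1 : ℕ) + 1) *ᵥ toReal x) p.2 : ℝ) : UnitAddCircle) := by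
    funext p
    rw [shearTorus, shear_errors]
    simp [toReal]
  rw [h, mFourier_coe]
  congr 2
  simp only [Matrix.mulVec, dotProduct, toReal]
  push_cast
  simp only [Finset.mul_sum, Finset.sum_mul]
  rw [Finset.sum_comm]
  simp only [mul_assoc]

/-- Were all entries integers, a nontrivial integer combination of rows of `L, …, L^N` would be an
integer combination of rows of the identity. -/
theorem exists_not_int_of_nonresonant (hres : InfNonresonant (stackedPowers L))
    {m : Fin N × Fin n → ℤ} (hm : m ≠ 0) :
    ∃ j, ∀ z : ℤ, (∑ p, m p * (L ^ ((p.1 : ℕ) + 1)) p.2 j : ℝ) ≠ z := by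
  by_contra hcon
  push Not at hcon
  choose z hz using hcon
  let q : Fin N × Fin n ↪ {k : ℤ // k ≠ 0} × Fin n :=
    ⟨fun p => (⟨(p.1 : ℤ) + 1, by omega⟩, p.2), by
      rintro ⟨a, i⟩ ⟨b, j⟩ h
      simp only [Prod.mk.injEq, Subtype.mk.injEq] at h
      obtain ⟨h1, rfl⟩ := h
      rw [Prod.mk.injEq]
      exact ⟨Fin.ext (by omega), rfl⟩⟩
  have h := hres _ (finProdFinEquiv.symm.toEmbedding.trans q)
  rw [Nonresonant, Fintype.linearIndependent_iff] at h
  have h0 := h (Sum.elim (fun j => -(z j : ℚ)) fun p => (m (finProdFinEquiv.symm p) : ℚ)) (by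
    ext j
    rw [Fintype.sum_sum_type]
    simp only [Pi.add_apply, Finset.sum_apply, Sum.elim_inl, Sum.elim_inr, Matrix.row,
      Matrix.fromRows_apply_inl, Matrix.fromRows_apply_inr, Pi.smul_apply, Pi.zero_apply]
    have h1 : ∑ c, (-(z c : ℚ)) • (1 : Matrix (Fin n) (Fin n) ℝ) c j = -(z j : ℝ) := by
      rw [Finset.sum_eq_single j]
      · simp [Rat.smul_def]
      · intro b _ hb; simp [Matrix.one_apply_ne hb]
      · simp
    have h2 : ∑ c, (m (finProdFinEquiv.symm c) : ℚ) •
        (stackedPowers L) (q (finProdFinEquiv.symm c)) j = z j := by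
      rw [← hz j, ← finProdFinEquiv.symm.sum_comp]
      refine Finset.sum_congr rfl fun c _ => ?_
      simp only [stackedPowers, Matrix.of_apply, q, Rat.smul_def,
        Rat.cast_intCast]
      norm_cast
    exact (congrArg₂ (· + ·) h1 h2).trans (neg_add_cancel _))
  refine hm (funext fun p => ?_)
  have := h0 (Sum.inr (finProdFinEquiv p))
  rw [Sum.elim_inr, Equiv.symm_apply_apply] at this
  exact_mod_cast this

/-- The frequencies of error patterns are the probabilities under independent uniform errors. -/
theorem tendsto_fraction_errors (hR : IsQuantizer R) (hres : InfNonresonant (stackedPowers L))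
    {C : Set (Fin N → Fin n → ℝ)} (hC : cellPi R N (frontier C) = 0) :
    Tendsto (fraction {x | errors R L N x ∈ C}) (boxFilter n) (𝓝 ((cellPi R N).real C)) := by
  have hp := hR.isProbabilityMeasure_cellPi (N := N)
  have hp' : IsProbabilityMeasure ((cellPi R N).map (shearTorus L N)) :=
    Measure.isProbabilityMeasure_map continuous_shearTorus.aemeasurable
  have key := tendsto_fraction_of_mFourier (n := n) (y := fun x => shearTorus L N (errors R L N x))
    ((cellPi R N).map (shearTorus L N)) (fun m => ?_) (map_shearTorus_frontier_null hR hC)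
  · rw [measureReal_def] at key ⊢
    rw [map_shearTorus_image hR hC] at key
    convert key using 2
    ext x
    -- Actual errors lie in the cell, so by injectivity the torus point decides whether they belong
    -- to `C`.
    have hx : errors R L N x ∈ Set.univ.pi fun _ => cell R := fun k _ => errors_mem_cell
        hR.map_add x k
    refine ⟨fun h => ⟨_, ⟨h, hx⟩, rfl⟩, ?_⟩
    rintro ⟨e, ⟨h1, h2⟩, h3⟩
    rw [shearTorus_injOn hR.map_add h2 hx h3] at h1
    exact h1
  · by_cases hm : m = 0
    · subst hm
      simp only [UnitAddTorus.mFourier_zero, ContinuousMap.one_apply, integral_const, probReal_univ,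
        one_smul]
      refine tendsto_const_nhds.congr' ?_
      filter_upwards [eventually_nonempty n] with P hP
      simp [average, hP.ne_empty]
    · rw [integral_mFourier_shearTorus hR hm]
      obtain ⟨j, hj⟩ := exists_not_int_of_nonresonant hres hm
      simp only [mFourier_shearTorus_errors]
      exact tendsto_average_exp hj

end ErrorFrequencies

/-! ### The covariance matrix of the cell -/

section Covariance

variable {n : ℕ} {R : (Fin n → ℝ) → (Fin n → ℤ)}

theorem IsQuantizer.integrableOn_cell {E : Type*} [NormedAddCommGroup E] (hR : IsQuantizer R)
    {f : (Fin n → ℝ) → E} (hf : Continuous f) : IntegrableOn f (cell R) :=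
  (hf.continuousOn.integrableOn_compact hR.jordan.1.isCompact_closure).mono_set subset_closure

theorem cellCov_quadratic (hR : IsQuantizer R) (x : Fin n → ℝ) :
    x ⬝ᵥ cellCov R *ᵥ x = ∫ u in cell R, (x ⬝ᵥ (u - cellMean R)) ^ 2 := by
  have h : ∀ u : Fin n → ℝ, (x ⬝ᵥ (u - cellMean R)) ^ 2 =
      ∑ i, ∑ j, x i * x j * ((u i - cellMean R i) * (u j - cellMean R j)) := by
    intro u
    rw [sq, dotProduct, Finset.sum_mul_sum]
    refine Finset.sum_congr rfl fun i _ => Finset.sum_congr rfl fun j _ => ?_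
    simp only [Pi.sub_apply]
    ring
  simp only [h]
  rw [integral_finsetSum _ fun i _ => hR.integrableOn_cell (by fun_prop)]
  simp only [dotProduct, Matrix.mulVec, Finset.mul_sum]
  refine Finset.sum_congr rfl fun i _ => ?_
  rw [integral_finsetSum _ fun j _ => hR.integrableOn_cell (by fun_prop)]
  refine Finset.sum_congr rfl fun j _ => ?_
  rw [integral_const_mul]
  simp only [cellCov, Matrix.of_apply]
  ring

theorem volume_hyperplane {x : Fin n → ℝ} (hx : x ≠ 0) (c : ℝ) :
    volume {u : Fin n → ℝ | x ⬝ᵥ u = c} = 0 := by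
  let ℓ : (Fin n → ℝ) →ₗ[ℝ] ℝ := dotProductBilin ℝ ℝ x
  have hℓ : Function.Surjective ℓ := by
    refine LinearMap.surjective fun h => hx ?_
    have : ℓ x = 0 := by rw [h]; rfl
    exact dotProduct_self_eq_zero.1 this
  have h := (ae_comp_linearMap_mem_iff ℓ volume volume hℓ
    (measurableSet_singleton c).compl).2 (by simp [ae_iff])
  rw [ae_iff] at h
  simp only [Set.mem_compl_iff, Set.mem_singleton_iff, not_not] at h
  exact h

/-- A null direction would confine the cell, up to a null set, to a hyperplane, but its volume is 1.
-/
theorem cellCov_posDef (hR : IsQuantizer R) : (cellCov R).PosDef := by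
  refine Matrix.PosDef.of_dotProduct_mulVec_pos ?_ fun x hx => ?_
  · ext i j
    simp only [Matrix.conjTranspose_apply, cellCov, Matrix.of_apply, star_trivial]
    simp only [mul_comm]
  rw [star_trivial, cellCov_quadratic hR]
  refine (setIntegral_pos_iff_support_of_nonneg_ae (.of_forall fun u => sq_nonneg _)
    (hR.integrableOn_cell (by unfold dotProduct; fun_prop))).2 ?_
  rw [pos_iff_ne_zero]
  intro h
  have h1 : volume (cell R) = 0 := by
    refine measure_mono_null (t := _ ∪ {u | x ⬝ᵥ u = x ⬝ᵥ cellMean R}) (fun u hu => ?_)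
      (measure_union_null h (volume_hyperplane hx _))
    by_cases hu' : x ⬝ᵥ u = x ⬝ᵥ cellMean R
    · exact Or.inr hu'
    · refine Or.inl ⟨?_, hu⟩
      rw [Function.mem_support, dotProduct_sub]
      exact pow_ne_zero 2 (sub_ne_zero.2 hu')
  rw [hR.volume_cell] at h1
  exact one_ne_zero h1

end Covariance

/-! ### Averages of rotations -/

theorem tendsto_mean_pow {w c : ℂ} (hw : w ≠ 1) (hw1 : ‖w‖ = 1) :
    Tendsto (fun N : ℕ => (1 / (N : ℝ) : ℝ) • ∑ ℓ ∈ Finset.range N, c * w ^ ℓ) atTop (𝓝 0) := by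
  refine squeeze_zero_norm (a := fun N : ℕ => 1 / (N : ℝ) * (‖c‖ * (2 / ‖w - 1‖))) (fun N => ?_) ?_
  · rw [norm_smul, ← Finset.mul_sum, norm_mul, geom_sum_eq hw, norm_div (w ^ N - 1),
      Real.norm_of_nonneg (by positivity)]
    have h2 : ‖w ^ N - 1‖ ≤ 2 := by
      refine (norm_sub_le _ _).trans ?_
      rw [norm_pow, hw1]
      norm_num
    gcongr
  · simpa using (tendsto_one_div_atTop_nhds_zero_nat (𝕜 := ℝ)).mul_const (‖c‖ * (2 / ‖w - 1‖))

theorem tendsto_mean_rotation {a : ℝ} (b : ℝ) (ha : Complex.exp (a * Complex.I) ≠ 1) :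
    Tendsto (fun N : ℕ => (1 / (N : ℝ)) • ∑ ℓ ∈ Finset.range N, rotation (ℓ * a + b)) atTop
        (𝓝 0) := by
  have h := tendsto_mean_pow (c := Complex.exp (b * Complex.I)) ha (Complex.norm_exp_ofReal_mul_I a)
  have he : ∀ ℓ : ℕ, Complex.exp (b * Complex.I) * Complex.exp (a * Complex.I) ^ ℓ =
      Complex.exp (((ℓ * a + b : ℝ) : ℂ) * Complex.I) := by
    intro ℓ
    rw [← Complex.exp_nat_mul, ← Complex.exp_add]
    push_cast; ring_nf
  simp only [he] at h
  have hre := (Complex.continuous_re.tendsto _).comp h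
  have him := (Complex.continuous_im.tendsto _).comp h
  have hcos : Tendsto (fun N : ℕ => (1 / (N : ℝ)) * ∑ ℓ ∈ Finset.range N, Real.cos (ℓ * a + b))
      atTop (𝓝 0) := by
    refine hre.congr fun N => ?_
    rw [Function.comp_apply, Complex.smul_re, Complex.re_sum]
    simp only [Complex.exp_ofReal_mul_I_re, smul_eq_mul]
  have hsin : Tendsto (fun N : ℕ => (1 / (N : ℝ)) * ∑ ℓ ∈ Finset.range N, Real.sin (ℓ * a + b))
      atTop (𝓝 0) := by
    refine him.congr fun N => ?_
    rw [Function.comp_apply, Complex.smul_im, Complex.im_sum]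
    simp only [Complex.exp_ofReal_mul_I_im, smul_eq_mul]
  refine tendsto_pi_nhds.2 fun i => tendsto_pi_nhds.2 fun j => ?_
  simp only [Matrix.smul_apply, Matrix.sum_apply, smul_eq_mul]
  fin_cases i <;> fin_cases j <;> simp [rotation] <;>
    first
    | simpa using hcos
    | simpa using hsin
    | simpa using hsin.neg

theorem rotation_zero : rotation 0 = 1 := by
  ext i j; fin_cases i <;> fin_cases j <;> simp [rotation]

theorem rotation_add (s t : ℝ) : rotation (s + t) = rotation s * rotation t := by
  ext i j
  fin_cases i <;> fin_cases j <;>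
    simp [rotation, Matrix.mul_apply, Fin.sum_univ_two, Real.cos_add, Real.sin_add] <;> ring

/-- The part of a planar matrix which commutes with rotations. -/
noncomputable def commutingPart (M : Matrix (Fin 2) (Fin 2) ℝ) : Matrix (Fin 2) (Fin 2) ℝ :=
  !![(M 0 0 + M 1 1) / 2, (M 0 1 - M 1 0) / 2; (M 1 0 - M 0 1) / 2, (M 0 0 + M 1 1) / 2]

/-- The commuting part `P` satisfies `P * rotation (-t) = rotation (-t) * P`; the remainder `Q` is
of reflection type, so `Q * rotation (-t) = rotation t * Q`. -/
theorem rotation_mul_mul_transpose (s t : ℝ) (M : Matrix (Fin 2) (Fin 2) ℝ) :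
    rotation s * M * (rotation t)ᵀ =
      rotation (s - t) * commutingPart M + rotation (s + t) * (M - commutingPart M) := by
  ext i j
  simp only [Matrix.add_apply, Matrix.mul_apply, Fin.sum_univ_two, Matrix.sub_apply,
    Matrix.transpose_apply]
  fin_cases i <;> fin_cases j <;>
    simp [rotation, commutingPart, Real.cos_add, Real.sin_add, Real.cos_sub, Real.sin_sub] <;> ring

theorem commutingPart_of_symm {M : Matrix (Fin 2) (Fin 2) ℝ} (hM : Mᵀ = M) :
    commutingPart M = (M.trace / 2) • (1 : Matrix (Fin 2) (Fin 2) ℝ) := by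
  have h : M 1 0 = M 0 1 := congrFun (congrFun hM 0) 1
  ext i j
  fin_cases i <;> fin_cases j <;> simp [commutingPart, Matrix.trace, Fin.sum_univ_two, h]

theorem tendsto_mean_conj_rotation {a a' : ℝ} (b b' : ℝ) (M : Matrix (Fin 2) (Fin 2) ℝ)
    {c : ℝ} (hadd : Complex.exp ((a + a' : ℝ) * Complex.I) ≠ 1)
    (hsub : (a = a' ∧ b = b' ∧ c = 1) ∨ (Complex.exp ((a - a' : ℝ) * Complex.I) ≠ 1 ∧ c = 0)) :
    Tendsto (fun N : ℕ => (1 / (N : ℝ)) • ∑ ℓ ∈ Finset.range N,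
      rotation (ℓ * a + b) * M * (rotation (ℓ * a' + b'))ᵀ) atTop (𝓝 (c • commutingPart M)) := by
  have hmul : ∀ (A : Matrix (Fin 2) (Fin 2) ℝ) (B : Matrix (Fin 2) (Fin 2) ℝ)
      {f : ℕ → Matrix (Fin 2) (Fin 2) ℝ}, Tendsto f atTop (𝓝 A) →
      Tendsto (fun N => f N * B) atTop (𝓝 (A * B)) := fun A B f hf =>
    ((continuous_id.matrix_mul continuous_const).tendsto A).comp hf
  have h1 := hmul _ (M - commutingPart M) (tendsto_mean_rotation (b + b') hadd)
  have h2 : Tendsto (fun N : ℕ => ((1 / (N : ℝ)) • ∑ ℓ ∈ Finset.range N,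
      rotation (ℓ * (a - a') + (b - b'))) * commutingPart M) atTop (𝓝 (c • commutingPart M)) := by
    rcases hsub with ⟨rfl, rfl, rfl⟩ | ⟨h, rfl⟩
    · rw [one_smul]
      refine tendsto_const_nhds.congr' ?_
      filter_upwards [eventually_gt_atTop 0] with N hN
      simp only [sub_self, mul_zero, add_zero, rotation_zero, Finset.sum_const, Finset.card_range,
        ← Nat.cast_smul_eq_nsmul ℝ, smul_smul]
      rw [one_div_mul_cancel (by positivity), one_smul, one_mul]
    · simpa using hmul _ (commutingPart M) (tendsto_mean_rotation (b - b') h)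
  have h3 := h2.add h1
  rw [zero_mul, add_zero] at h3
  refine h3.congr fun N => ?_
  simp only [rotation_mul_mul_transpose, Finset.sum_add_distrib, smul_add, ← Finset.sum_mul,
    Matrix.smul_mul]
  have hs : ∀ ℓ : ℕ, (ℓ * (a - a') + (b - b') : ℝ) = ℓ * a + b - (ℓ * a' + b') := fun ℓ => by ring
  have ha : ∀ ℓ : ℕ, (ℓ * (a + a') + (b + b') : ℝ) = ℓ * a + b + (ℓ * a' + b') := fun ℓ => by ring
  simp only [hs, ha]

/-! ### Averaged covariance matrices -/

section Neutral

variable {r : ℕ} {U : Matrix (Fin (r * 2)) (Fin (r * 2)) ℝ}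

theorem rowBlock_mul_colBlock (hU : IsUnit U.det) (k l : Fin r) :
    rowBlock U k * colBlock U l = if k = l then 1 else 0 := by
  have h : rowBlock U k * colBlock U l = (U⁻¹ * U).submatrix (fun j => finProdFinEquiv (k, j))
      (fun j => finProdFinEquiv (l, j)) := by
    rw [rowBlock, colBlock, Matrix.submatrix_mul _ _ _ id _ Function.bijective_id]
  rw [h, Matrix.nonsing_inv_mul U hU]
  ext i j
  rw [Matrix.submatrix_apply, Matrix.one_apply]
  by_cases hkl : k = l
  · subst hkl
    simp [Matrix.one_apply]
  · simp [hkl]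

theorem sum_colBlock_mul_rowBlock (hU : IsUnit U.det) : ∑ k, colBlock U k * rowBlock U k = 1 := by
  rw [← Matrix.mul_nonsing_inv U hU]
  ext i j
  rw [Matrix.sum_apply, Matrix.mul_apply, ← finProdFinEquiv.sum_comp, Fintype.sum_prod_type]
  rfl

theorem neutralMatrix_zero (hU : IsUnit U.det) : neutralMatrix U 0 = 1 := by
  simp [neutralMatrix, rotation_zero, sum_colBlock_mul_rowBlock hU]

/-- The blocks satisfy `V_k U_l = δ_kl`, so rotation angles add; integer powers of `L` thus stay in
this family. -/
theorem neutralMatrix_add (hU : IsUnit U.det) (s t : Fin r → ℝ) :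
    neutralMatrix U (s + t) = neutralMatrix U s * neutralMatrix U t := by
  simp only [neutralMatrix, Finset.sum_mul_sum]
  refine Finset.sum_congr rfl fun k _ => ?_
  have h : ∀ l, colBlock U k * rotation (s k) * rowBlock U k * (colBlock U l * rotation (t l) *
      rowBlock U l)
      = colBlock U k * rotation (s k) * (rowBlock U k * colBlock U l) * rotation (t l) * rowBlock
          U l := by
    intro l; simp only [Matrix.mul_assoc]
  simp only [h, rowBlock_mul_colBlock hU]
  rw [Finset.sum_eq_single k]
  · simp [rotation_add, Matrix.mul_assoc]
  · intro l _ hl; simp [hl.symm]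
  · simp

theorem neutralMatrix_pow (hU : IsUnit U.det) (θ : Fin r → ℝ) (ℓ : ℕ) :
    neutralMatrix U θ ^ ℓ = neutralMatrix U fun k => ℓ * θ k := by
  induction ℓ with
  | zero => simp only [pow_zero, Nat.cast_zero, zero_mul]; exact (neutralMatrix_zero hU).symm
  | succ ℓ ih =>
    rw [pow_succ, ih, ← neutralMatrix_add hU]
    congr 1
    funext k
    simp only [Pi.add_apply]
    push_cast; ring

theorem neutralMatrix_zpow_neg (hU : IsUnit U.det) (θ : Fin r → ℝ) (ℓ : ℕ) :
    neutralMatrix U θ ^ (-(ℓ : ℤ)) = neutralMatrix U fun k => -(ℓ * θ k) := by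
  have h : (neutralMatrix U fun k => -(ℓ * θ k)) * neutralMatrix U θ ^ ℓ = 1 := by
    rw [neutralMatrix_pow hU, ← neutralMatrix_add hU, ← neutralMatrix_zero hU]
    congr 1
    funext k
    simp
  rw [Matrix.zpow_neg_natCast]
  exact Matrix.inv_eq_left_inv h

theorem neutralMatrix_conj (s : Fin r → ℝ) (Ψ : Matrix (Fin (r * 2)) (Fin (r * 2)) ℝ) :
    neutralMatrix U s * Ψ * (neutralMatrix U s)ᵀ = ∑ k, ∑ l, colBlock U k *
      (rotation (s k) * (rowBlock U k * Ψ * (rowBlock U l)ᵀ) * (rotation (s l))ᵀ) *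
        (colBlock U l)ᵀ := by
  simp only [neutralMatrix, Matrix.transpose_sum, Finset.sum_mul, Finset.mul_sum,
    Matrix.transpose_mul]
  rw [Finset.sum_comm]
  simp only [Matrix.mul_assoc]

/-- Averages of `N_ℓ Ψ N_ℓᵀ` along an arithmetic progression of rotation angles. -/
theorem tendsto_mean_conj_neutral {α : Fin r → ℝ} (β : Fin r → ℝ)
    {Ψ : Matrix (Fin (r * 2)) (Fin (r * 2)) ℝ} (hΨ : Ψ.PosSemidef)
    (hadd : ∀ k l, Complex.exp ((α k + α l : ℝ) * Complex.I) ≠ 1)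
    (hsub : ∀ k l, k ≠ l → Complex.exp ((α k - α l : ℝ) * Complex.I) ≠ 1) :
    Tendsto (fun N : ℕ => (1 / (N : ℝ)) • ∑ ℓ ∈ Finset.range N,
      (neutralMatrix U fun k => ℓ * α k + β k) * Ψ * (neutralMatrix U fun k => ℓ * α k + β k)ᵀ)
      atTop (𝓝 (limitCov U Ψ)) := by
  have hmul : ∀ (k l : Fin r) (A : Matrix (Fin 2) (Fin 2) ℝ)
      {f : ℕ → Matrix (Fin 2) (Fin 2) ℝ}, Tendsto f atTop (𝓝 A) →
      Tendsto (fun N => colBlock U k * f N * (colBlock U l)ᵀ) atTop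
        (𝓝 (colBlock U k * A * (colBlock U l)ᵀ)) := fun k l A f hf =>
    (((continuous_const.matrix_mul continuous_id).matrix_mul continuous_const).tendsto A).comp hf
  have key := tendsto_finsetSum Finset.univ fun k _ => tendsto_finsetSum Finset.univ fun l _ =>
    hmul k l _ (tendsto_mean_conj_rotation (β k) (β l) (rowBlock U k * Ψ * (rowBlock U l)ᵀ)
      (c := if k = l then 1 else 0) (hadd k l) (by
        by_cases h : k = l
        · subst h; exact Or.inl ⟨rfl, rfl, by simp⟩
        · exact Or.inr ⟨hsub k l h, by simp [h]⟩))
  have hlim : ∑ k, ∑ l, colBlock U k * ((if k = l then (1 : ℝ) else 0) •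
      commutingPart (rowBlock U k * Ψ * (rowBlock U l)ᵀ)) * (colBlock U l)ᵀ = limitCov U Ψ := by
    rw [limitCov, Finset.smul_sum]
    refine Finset.sum_congr rfl fun k _ => ?_
    rw [Finset.sum_eq_single k]
    · have hs : (rowBlock U k * Ψ * (rowBlock U k)ᵀ)ᵀ = rowBlock U k * Ψ * (rowBlock U k)ᵀ := by
        have : Ψᵀ = Ψ := hΨ.isHermitian
        simp only [Matrix.transpose_mul, Matrix.transpose_transpose, this, Matrix.mul_assoc]
      have ht : 0 ≤ (rowBlock U k * Ψ * (rowBlock U k)ᵀ).trace :=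
        (hΨ.mul_mul_conjTranspose_same (rowBlock U k)).trace_nonneg
      rw [commutingPart_of_symm hs, sigma, Real.sq_sqrt ht]
      simp only [if_true, Matrix.mul_smul, Matrix.smul_mul, Matrix.mul_one, smul_smul]
      congr 1
      ring
    · intro l _ hl; simp [hl.symm]
    · simp
  rw [hlim] at key
  refine key.congr fun N => ?_
  simp only [neutralMatrix_conj]
  symm
  rw [Finset.sum_comm, Finset.smul_sum]
  refine Finset.sum_congr rfl fun k _ => ?_
  rw [Finset.sum_comm, Finset.smul_sum]
  refine Finset.sum_congr rfl fun l _ => ?_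
  rw [Matrix.mul_smul, Matrix.smul_mul, Matrix.mul_sum, Matrix.sum_mul]

/-- The case `k = l` is included: it excludes real eigenvalues and kills the reflection part of the
diagonal blocks. -/
theorem NondegenerateSpectrum.exp_add_ne_one {θ : Fin r → ℝ} (h : NondegenerateSpectrum θ)
    (k l : Fin r) : Complex.exp ((θ k + θ l : ℝ) * Complex.I) ≠ 1 := by
  intro he
  have : Sum.inl k = Sum.inr l := h (by
    simp only [Sum.elim_inl, Sum.elim_inr]
    rw [Complex.exp_neg, eq_comm, inv_eq_iff_eq_inv, ← mul_eq_one_iff_eq_inv₀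
        (Complex.exp_ne_zero _),
      ← Complex.exp_add, ← he]
    push_cast; ring_nf)
  simp at this

theorem NondegenerateSpectrum.exp_sub_ne_one {θ : Fin r → ℝ} (h : NondegenerateSpectrum θ)
    {k l : Fin r} (hkl : k ≠ l) : Complex.exp ((θ k - θ l : ℝ) * Complex.I) ≠ 1 := by
  intro he
  refine hkl (Sum.inl_injective (β := Fin r) (h ?_))
  simp only [Sum.elim_inl]
  rw [← div_eq_one_iff_eq (Complex.exp_ne_zero _), ← Complex.exp_sub, ← he]
  push_cast; ring_nf

theorem exp_neg_ne_one {a b : ℝ} (hab : b = -a) (h : Complex.exp (a * Complex.I) ≠ 1) :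
    Complex.exp (b * Complex.I) ≠ 1 := by
  subst hab
  push_cast
  rwa [neg_mul, Complex.exp_neg, ne_eq, inv_eq_one]

theorem tendsto_averagedCov {θ : Fin r → ℝ} (hU : IsUnit U.det) (h : NondegenerateSpectrum θ)
    {Ψ : Matrix (Fin (r * 2)) (Fin (r * 2)) ℝ} (hΨ : Ψ.PosSemidef) :
    Tendsto (averagedCov (neutralMatrix U θ) Ψ) atTop (𝓝 (limitCov U Ψ)) := by
  -- The offset `-θ k` accounts for the sum starting at `ℓ = 1`.
  refine (tendsto_mean_conj_neutral (U := U) (α := fun k => -θ k) (fun k => -θ k) hΨ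
    (fun k l => exp_neg_ne_one (by ring) (h.exp_add_ne_one k l))
    fun k l hkl => exp_neg_ne_one (by ring) (h.exp_sub_ne_one hkl)).congr fun N => ?_
  have hI : Finset.Icc 1 N = (Finset.range N).map (addRightEmbedding 1) := by
    rw [Finset.range_eq_Ico, Finset.map_add_right_Ico]
    rfl
  rw [averagedCov, hI, Finset.sum_map]
  simp only [addRightEmbedding_apply, neutralMatrix_zpow_neg hU]
  have hs : ∀ (ℓ : ℕ) (k : Fin r), (ℓ * -θ k + -θ k : ℝ) = -((ℓ + 1 : ℕ) * θ k) := fun ℓ k => by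
    push_cast; ring
  simp only [hs]

/-- The deviation involves nonnegative powers of `L`, whereas `Φ` is defined through negative ones;
both averages have the same limit. -/
theorem tendsto_forward_averagedCov {θ : Fin r → ℝ} (hU : IsUnit U.det)
    (h : NondegenerateSpectrum θ) {Ψ : Matrix (Fin (r * 2)) (Fin (r * 2)) ℝ} (hΨ : Ψ.PosSemidef) :
    Tendsto (fun N : ℕ => (1 / (N : ℝ)) • ∑ ℓ ∈ Finset.range N,
      neutralMatrix U θ ^ ℓ * Ψ * (neutralMatrix U θ ^ ℓ)ᵀ) atTop (𝓝 (limitCov U Ψ)) := by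
  refine (tendsto_mean_conj_neutral (U := U) (α := θ) 0 hΨ h.exp_add_ne_one
    fun k l => h.exp_sub_ne_one).congr fun N => ?_
  simp only [neutralMatrix_pow hU, Pi.zero_apply, add_zero]

/-- Since `V_k U_k = 1`, the rows of `V_k` are independent and `V_k Ψ V_kᵀ` is positive definite. -/
theorem sigma_pos (hU : IsUnit U.det) {Ψ : Matrix (Fin (r * 2)) (Fin (r * 2)) ℝ} (hΨ : Ψ.PosDef)
    (k : Fin r) : 0 < sigma U Ψ k := by
  refine Real.sqrt_pos.2 (hΨ.mul_mul_conjTranspose_same (B := rowBlock U k) fun x y h =>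
      ?_).trace_pos
  have := congrArg (fun v => v ᵥ* colBlock U k) h
  simpa [Matrix.vecMul_vecMul, rowBlock_mul_colBlock hU] using this

theorem limitCov_posDef (hU : IsUnit U.det) {Ψ : Matrix (Fin (r * 2)) (Fin (r * 2)) ℝ}
    (hΨ : Ψ.PosDef) : (limitCov U Ψ).PosDef := by
  rw [← blockRoot_mul_transpose]
  have h : blockRoot U Ψ = U * Matrix.diagonal fun p => 1 / √2 * sigma U Ψ (finProdFinEquiv.symm
      p).1 := by
    ext i p
    rw [Matrix.mul_diagonal, blockRoot, Matrix.of_apply]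
    ring
  refine Matrix.PosDef.mul_conjTranspose_self _ ?_
  rw [Matrix.vecMul_injective_iff_isUnit, Matrix.isUnit_iff_isUnit_det, h, Matrix.det_mul,
    Matrix.det_diagonal]
  refine hU.mul (isUnit_iff_ne_zero.2 (Finset.prod_ne_zero_iff.2 fun p _ => ?_))
  have := sigma_pos hU hΨ (finProdFinEquiv.symm p).1
  positivity

end Neutral

/-! ### The central limit theorem for sums of independent cell-uniform vectors -/

theorem norm_prod_sub_prod_le {ι : Type*} (s : Finset ι) {a b : ι → ℂ}
    (ha : ∀ i ∈ s, ‖a i‖ ≤ 1) (hb : ∀ i ∈ s, ‖b i‖ ≤ 1) :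
    ‖∏ i ∈ s, a i - ∏ i ∈ s, b i‖ ≤ ∑ i ∈ s, ‖a i - b i‖ := by
  classical
  induction s using Finset.induction_on with
  | empty => simp
  | insert i s hi ih =>
    rw [Finset.prod_insert hi, Finset.prod_insert hi, Finset.sum_insert hi]
    have h1 : a i * ∏ j ∈ s, a j - b i * ∏ j ∈ s, b j =
        (a i - b i) * ∏ j ∈ s, a j + b i * (∏ j ∈ s, a j - ∏ j ∈ s, b j) := by ring
    rw [h1]
    refine (norm_add_le _ _).trans (add_le_add ?_ ?_)
    · rw [norm_mul, norm_prod]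
      exact mul_le_of_le_one_right (norm_nonneg _) (Finset.prod_le_one (fun _ _ => norm_nonneg _)
        fun j hj => ha j (Finset.mem_insert_of_mem hj))
    · rw [norm_mul]
      exact (mul_le_of_le_one_left (norm_nonneg _) (hb i (Finset.mem_insert_self i s))).trans
        (ih (fun j hj => ha j (Finset.mem_insert_of_mem hj))
          fun j hj => hb j (Finset.mem_insert_of_mem hj))

theorem norm_exp_mul_I_taylor {x : ℝ} (hx : |x| ≤ 1) :
    ‖Complex.exp (x * Complex.I) - (1 + x * Complex.I - x ^ 2 / 2)‖ ≤ |x| ^ 3 := by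
  have h : ‖(x * Complex.I : ℂ)‖ ≤ 1 := by simpa using hx
  have h3 := Complex.exp_bound h (n := 3) (by norm_num)
  have hs : ∑ m ∈ Finset.range 3, (x * Complex.I : ℂ) ^ m / (m.factorial : ℂ) =
      1 + x * Complex.I - x ^ 2 / 2 := by
    simp [Finset.sum_range_succ, mul_pow]
    ring
  rw [hs] at h3
  refine h3.trans ?_
  simp only [norm_mul, Complex.norm_real, Complex.norm_I, mul_one, Real.norm_eq_abs]
  refine mul_le_of_le_one_right (by positivity) ?_
  norm_num [Nat.factorial]

section CLT

variable {n : ℕ} {R : (Fin n → ℝ) → (Fin n → ℤ)}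

/-- The characteristic function of a centred vector, uniformly distributed over the cell. -/
noncomputable def cellCharFun (R : (Fin n → ℝ) → (Fin n → ℤ)) (w : Fin n → ℝ) : ℂ :=
  ∫ u in cell R, Complex.exp ((w ⬝ᵥ (u - cellMean R) : ℝ) * Complex.I)

theorem integral_centred_cell (hR : IsQuantizer R) (w : Fin n → ℝ) :
    ∫ u in cell R, w ⬝ᵥ (u - cellMean R) = 0 := by
  have := hR.isProbabilityMeasure
  simp only [dotProduct]
  rw [integral_finsetSum _ fun i _ => hR.integrableOn_cell (by fun_prop)]
  refine Finset.sum_eq_zero fun i _ => ?_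
  rw [integral_const_mul]
  simp only [Pi.sub_apply]
  rw [integral_sub (hR.integrableOn_cell (by fun_prop)) (integrable_const _), integral_const,
    probReal_univ, one_smul, cellMean, sub_self, mul_zero]

theorem norm_cellCharFun_le_one (hR : IsQuantizer R) (w : Fin n → ℝ) : ‖cellCharFun R w‖ ≤ 1 := by
  have := hR.isProbabilityMeasure
  refine (norm_integral_le_of_norm_le_const (C := 1) (.of_forall fun u => ?_)).trans (by simp)
  rw [Complex.norm_exp_ofReal_mul_I]

/-- Both terms are within `b ^ 3` of `1 - q / 2`: the first by Taylor expansion, the linear term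
having mean zero; the second because its error is of order `q ^ 2 ≤ b ^ 4`. -/
theorem norm_cellCharFun_sub_exp_le (hR : IsQuantizer R) {w : Fin n → ℝ} {b : ℝ} (hb : b ≤ 1)
    (h : ∀ u ∈ cell R, |w ⬝ᵥ (u - cellMean R)| ≤ b) :
    ‖cellCharFun R w - Complex.exp ((-(w ⬝ᵥ cellCov R *ᵥ w) / 2 : ℝ))‖ ≤ 2 * b ^ 3 := by
  have := hR.isProbabilityMeasure
  have hcont : Continuous fun u : Fin n → ℝ => w ⬝ᵥ (u - cellMean R) := by
    unfold dotProduct; fun_prop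
  have hb0 : 0 ≤ b := (abs_nonneg _).trans (h _ (sub_toReal_mem_cell hR.map_add 0))
  set q := w ⬝ᵥ cellCov R *ᵥ w with hq
  have hq0 : 0 ≤ q := by
    rw [hq, cellCov_quadratic hR]; exact integral_nonneg fun u => sq_nonneg _
  have hae : ∀ᵐ u ∂(volume.restrict (cell R)), u ∈ cell R :=
    ae_restrict_mem₀ hR.nullMeasurableSet_cell
  have hqb : q ≤ b ^ 2 := by
    rw [hq, cellCov_quadratic hR]
    refine (integral_mono_ae (hR.integrableOn_cell (by fun_prop)) (integrable_const (b ^ 2))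
        ?_).trans
      (by simp)
    filter_upwards [hae] with u hu
    exact sq_le_sq' (abs_le.1 (h u hu)).1 (abs_le.1 (h u hu)).2
  have h1 : ‖cellCharFun R w - (1 - q / 2 : ℝ)‖ ≤ b ^ 3 := by
    have hint : ((1 - q / 2 : ℝ) : ℂ) = ∫ u in cell R, (1 + (w ⬝ᵥ (u - cellMean R) : ℝ) *
        Complex.I -
        ((w ⬝ᵥ (u - cellMean R) : ℝ) : ℂ) ^ 2 / 2) := by
      have e1 : ∫ u in cell R, ((w ⬝ᵥ (u - cellMean R) : ℝ) : ℂ) * Complex.I = 0 := by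
        rw [integral_mul_const, integral_complex_ofReal, integral_centred_cell hR]; simp
      have e2 : ∫ u in cell R, ((w ⬝ᵥ (u - cellMean R) : ℝ) : ℂ) ^ 2 / 2 = (q : ℂ) / 2 := by
        rw [integral_div]
        have : ∀ u : Fin n → ℝ, ((w ⬝ᵥ (u - cellMean R) : ℝ) : ℂ) ^ 2 =
            (((w ⬝ᵥ (u - cellMean R)) ^ 2 : ℝ) : ℂ) := fun u => by push_cast; rfl
        simp only [this]
        rw [integral_complex_ofReal, ← cellCov_quadratic hR]
      rw [integral_sub (hR.integrableOn_cell (by fun_prop)) (hR.integrableOn_cell (by fun_prop)),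
        integral_add (hR.integrableOn_cell continuous_const) (hR.integrableOn_cell (by
            fun_prop)), e1, e2]
      simp
    rw [hint, cellCharFun, ← integral_sub (hR.integrableOn_cell (by fun_prop))
      (hR.integrableOn_cell (by fun_prop))]
    refine (norm_integral_le_of_norm_le_const (C := b ^ 3) ?_).trans (by simp)
    filter_upwards [hae] with u hu
    refine (norm_exp_mul_I_taylor ((h u hu).trans hb)).trans ?_
    exact pow_le_pow_left₀ (abs_nonneg _) (h u hu) 3
  have h2 : |Real.exp (-q / 2) - (1 - q / 2)| ≤ b ^ 3 := by
    have hq1 : q ≤ 1 := hqb.trans (pow_le_one₀ hb0 hb)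
    have hx : |-q / 2| ≤ 1 := by rw [abs_le]; constructor <;> linarith
    have h3 := Real.exp_bound hx (n := 2) (by norm_num)
    have hs : ∑ m ∈ Finset.range 2, (-q / 2) ^ m / (m.factorial : ℝ) = 1 - q / 2 := by
      simp [Finset.sum_range_succ]; ring
    rw [hs] at h3
    refine h3.trans ?_
    rw [sq_abs]
    norm_num [Nat.factorial]
    have h4 : q ^ 2 ≤ b ^ 3 := by
      calc q ^ 2 ≤ (b ^ 2) ^ 2 := pow_le_pow_left₀ hq0 hqb 2
        _ = b ^ 3 * b := by ring
        _ ≤ b ^ 3 := mul_le_of_le_one_right (by positivity) hb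
    nlinarith
  calc _ = ‖(cellCharFun R w - (1 - q / 2 : ℝ)) -
        ((Real.exp (-q / 2) - (1 - q / 2) : ℝ) : ℂ)‖ := by
        congr 1; push_cast; ring
    _ ≤ b ^ 3 + b ^ 3 := (norm_sub_le _ _).trans (add_le_add h1 (by
        rw [Complex.norm_real]; exact h2))
    _ = _ := by ring

/-- The map which expresses the normalized deviation through quantization errors. -/
noncomputable def weightedSum (R : (Fin n → ℝ) → (Fin n → ℤ)) {N : ℕ}
    (A : Fin N → Matrix (Fin n) (Fin n) ℝ) (e : Fin N → Fin n → ℝ) : Fin n → ℝ :=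
  ∑ k, A k *ᵥ (e k - cellMean R)

theorem continuous_weightedSum {N : ℕ} (A : Fin N → Matrix (Fin n) (Fin n) ℝ) :
    Continuous (weightedSum R A) := by
  unfold weightedSum Matrix.mulVec dotProduct
  fun_prop

theorem integral_exp_weightedSum (hR : IsQuantizer R) {N : ℕ} (A : Fin N → Matrix (Fin n) (Fin n) ℝ)
    (t : Fin n → ℝ) :
    ∫ e, Complex.exp ((t ⬝ᵥ weightedSum R A e : ℝ) * Complex.I) ∂(cellPi R N) =
      ∏ k, cellCharFun R (t ᵥ* A k) := by
  have := hR.isProbabilityMeasure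
  have h : ∀ e : Fin N → Fin n → ℝ, Complex.exp ((t ⬝ᵥ weightedSum R A e : ℝ) * Complex.I) =
      ∏ k, Complex.exp (((t ᵥ* A k) ⬝ᵥ (e k - cellMean R) : ℝ) * Complex.I) := by
    intro e
    rw [← Complex.exp_sum, ← Finset.sum_mul, ← Complex.ofReal_sum, weightedSum, dotProduct_sum]
    simp only [Matrix.dotProduct_mulVec]
  simp only [h]
  exact integral_fintype_prod_eq_prod (fun k (u : Fin n → ℝ) =>
    Complex.exp (((t ᵥ* A k) ⬝ᵥ (u - cellMean R) : ℝ) * Complex.I))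

/-- The distribution of a weighted sum of independent vectors, uniform over the cell. -/
noncomputable def weightedLaw (hR : IsQuantizer R) {N : ℕ} (A : Fin N → Matrix (Fin n) (Fin n) ℝ) :
    ProbabilityMeasure (Fin n → ℝ) :=
  ⟨(cellPi R N).map (weightedSum R A),
    have := hR.isProbabilityMeasure_cellPi (N := N)
    Measure.isProbabilityMeasure_map (continuous_weightedSum A).aemeasurable⟩

theorem dotProduct_cov_mulVec (Ψ A : Matrix (Fin n) (Fin n) ℝ) (t : Fin n → ℝ) :
    (t ᵥ* A) ⬝ᵥ Ψ *ᵥ (t ᵥ* A) = t ⬝ᵥ (A * Ψ * Aᵀ) *ᵥ t := by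
  rw [← Matrix.mulVec_transpose A t, Matrix.mulVec_mulVec, Matrix.mulVec_transpose,
    ← Matrix.dotProduct_mulVec, Matrix.mulVec_mulVec, Matrix.mul_assoc]

/-- A central limit theorem for triangular arrays of weights of order `1 / √N`. -/
theorem tendsto_weightedLaw (hR : IsQuantizer R)
    {A : (N : ℕ) → Fin N → Matrix (Fin n) (Fin n) ℝ}
    (hbd : ∀ t : Fin n → ℝ, ∃ M : ℝ, ∀ N k, ∀ u ∈ cell R,
      |(t ᵥ* A N k) ⬝ᵥ (u - cellMean R)| ≤ M / √N)
    (hcov : Tendsto (fun N => ∑ k, A N k * cellCov R * (A N k)ᵀ) atTop (𝓝 1)) :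
    Tendsto (fun N => weightedLaw hR (A N)) atTop (𝓝 (standardGaussian n)) := by
  -- Characteristic functions need an inner product, so convergence is proved in Euclidean space and
  -- carried back.
  let toE : (Fin n → ℝ) → EuclideanSpace ℝ (Fin n) := WithLp.toLp 2
  have htoE : Continuous toE := PiLp.continuous_toLp 2 _
  have hofE : Continuous (WithLp.ofLp : EuclideanSpace ℝ (Fin n) → (Fin n → ℝ)) :=
    PiLp.continuous_ofLp 2 _
  suffices h : Tendsto (fun N => (weightedLaw hR (A N)).map htoE.measurable.aemeasurable) atTop
      (𝓝 ((standardGaussian n).map htoE.measurable.aemeasurable)) by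
    have h2 := ProbabilityMeasure.tendsto_map_of_tendsto_of_continuous _ _ h hofE
    have hid : ∀ ν : ProbabilityMeasure (Fin n → ℝ),
        (ν.map htoE.measurable.aemeasurable).map hofE.measurable.aemeasurable = ν := by
      intro ν
      apply Subtype.ext
      change ((ν : Measure _).map toE).map WithLp.ofLp = ν
      rw [Measure.map_map hofE.measurable htoE.measurable]
      exact Measure.map_id
    simpa only [hid] using h2
  refine ProbabilityMeasure.tendsto_iff_tendsto_charFun.2 fun t => ?_
  have hgauss : charFun (((standardGaussian n).map htoE.measurable.aemeasurable :
      ProbabilityMeasure _) : Measure (EuclideanSpace ℝ (Fin n))) t =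
      Complex.exp ((-(t.ofLp ⬝ᵥ t.ofLp) / 2 : ℝ)) := by
    change charFun ((Measure.pi fun _ => gaussianReal 0 1).map (WithLp.toLp 2)) t = _
    rw [map_pi_eq_stdGaussian, charFun_stdGaussian, ← Complex.ofReal_pow,
      EuclideanSpace.real_norm_sq_eq]
    simp [dotProduct, sq]
  have hlaw : ∀ N, charFun (((weightedLaw hR (A N)).map htoE.measurable.aemeasurable :
      ProbabilityMeasure _) : Measure (EuclideanSpace ℝ (Fin n))) t =
      ∏ k, cellCharFun R (t.ofLp ᵥ* A N k) := by
    intro N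
    rw [← integral_exp_weightedSum hR]
    change charFun (((cellPi R N).map (weightedSum R (A N))).map toE) t = _
    rw [Measure.map_map htoE.measurable (continuous_weightedSum _).measurable, charFun_apply,
      integral_map (htoE.comp (continuous_weightedSum _)).aemeasurable (by fun_prop)]
    rfl
  rw [hgauss]
  simp only [hlaw]
  set v : Fin n → ℝ := t.ofLp with hv
  have hmain : Tendsto (fun N => ∏ k, Complex.exp ((-((v ᵥ* A N k) ⬝ᵥ cellCov R *ᵥ (v ᵥ* A N k))
      / 2 : ℝ)))
      atTop (𝓝 (Complex.exp ((-(v ⬝ᵥ v) / 2 : ℝ)))) := by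
    have h1 : Tendsto (fun N => v ⬝ᵥ (∑ k, A N k * cellCov R * (A N k)ᵀ) *ᵥ v) atTop
        (𝓝 (v ⬝ᵥ (1 : Matrix (Fin n) (Fin n) ℝ) *ᵥ v)) :=
      ((continuous_const.dotProduct (continuous_id.matrix_mulVec continuous_const)).tendsto
        (1 : Matrix (Fin n) (Fin n) ℝ)).comp hcov
    rw [Matrix.one_mulVec] at h1
    have h2 : Continuous fun s : ℝ => Complex.exp ((-s / 2 : ℝ)) := by fun_prop
    refine ((h2.tendsto _).comp h1).congr fun N => ?_
    rw [← Complex.exp_sum, ← Complex.ofReal_sum, Function.comp_apply]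
    simp only [dotProduct_cov_mulVec, Matrix.sum_mulVec, dotProduct_sum]
    rw [← Finset.sum_div, Finset.sum_neg_distrib]
  obtain ⟨M, hM⟩ := hbd v
  -- Replacing the `N` factors one at a time costs at most `2 (M / √N)^3` each, hence `2 M^3 / √N`
  -- in total.
  have herr : Tendsto (fun N => ∏ k, cellCharFun R (v ᵥ* A N k) -
      ∏ k, Complex.exp ((-((v ᵥ* A N k) ⬝ᵥ cellCov R *ᵥ (v ᵥ* A N k)) / 2 : ℝ))) atTop (𝓝 0) := by
    have hsq : Tendsto (fun N : ℕ => M / √(N : ℝ)) atTop (𝓝 0) :=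
      tendsto_const_nhds.div_atTop (Real.tendsto_sqrt_atTop.comp tendsto_natCast_atTop_atTop)
    refine squeeze_zero_norm' (a := fun N : ℕ => 2 * M ^ 2 * (M / √(N : ℝ))) ?_
      (by simpa using hsq.const_mul (2 * M ^ 2))
    filter_upwards [hsq.eventually_le_const zero_lt_one, eventually_gt_atTop 0] with N hN hN0
    refine (norm_prod_sub_prod_le _ (fun k _ => norm_cellCharFun_le_one hR _) fun k _ =>
        ?_).trans ?_
    · rw [← Complex.ofReal_exp, Complex.norm_real, Real.norm_of_nonneg (Real.exp_nonneg _),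
        Real.exp_le_one_iff, cellCov_quadratic hR]
      have : 0 ≤ ∫ u in cell R, ((v ᵥ* A N k) ⬝ᵥ (u - cellMean R)) ^ 2 :=
        integral_nonneg fun u => sq_nonneg _
      linarith
    · refine (Finset.sum_le_sum fun k _ => norm_cellCharFun_sub_exp_le hR hN (hM N k)).trans ?_
      rw [Finset.sum_const, Finset.card_univ, Fintype.card_fin, nsmul_eq_mul]
      have hs : 0 < √(N : ℝ) := Real.sqrt_pos.2 (by exact_mod_cast hN0)
      have hs2 : (N : ℝ) = √(N : ℝ) ^ 2 := (Real.sq_sqrt (Nat.cast_nonneg N)).symm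
      rw [div_pow]
      conv_lhs => rw [hs2]
      rw [Real.sqrt_sq hs.le]
      apply le_of_eq
      field_simp
  have := herr.add hmain
  simpa using this

end CLT

/-! ### The normalized deviation -/

section Deviation

variable {n : ℕ} {R : (Fin n → ℝ) → (Fin n → ℤ)} {L : Matrix (Fin n) (Fin n) ℝ}

theorem deviation_eq_sum (N : ℕ) (x : Fin n → ℤ) :
    deviation R L N x = ∑ k : Fin N, L ^ (N - 1 - (k : ℕ)) *ᵥ (errors R L N x k - cellMean R) := by
  let E : ℕ → Fin n → ℝ := fun k =>
    L *ᵥ toReal ((transition R L)^[k] x) - toReal ((transition R L)^[k + 1] x)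
  suffices h : deviation R L N x = ∑ k ∈ Finset.range N, L ^ (N - 1 - k) *ᵥ (E k - cellMean R) by
    rw [h, ← Fin.sum_univ_eq_sum_range (fun k => L ^ (N - 1 - k) *ᵥ (E k - cellMean R))]
    rfl
  induction N with
  | zero => simp [deviation]
  | succ N ih =>
    have h1 : deviation R L (N + 1) x = L *ᵥ deviation R L N x + (E N - cellMean R) := by
      simp only [deviation, E, Matrix.mulVec_sub]
      rw [Function.iterate_succ_apply' (supporting R L), supporting]
      abel
    rw [h1, ih, Finset.sum_range_succ, Matrix.mulVec_sum]
    congr 1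
    · refine Finset.sum_congr rfl fun k hk => ?_
      have := Finset.mem_range.1 hk
      rw [Matrix.mulVec_mulVec, ← pow_succ', show N - 1 - k + 1 = N + 1 - 1 - k by omega]
    · simp

/-- The weights of the quantization errors in the normalized deviation. -/
noncomputable def deviationWeight (L S : Matrix (Fin n) (Fin n) ℝ) (N : ℕ) (k : Fin N) :
    Matrix (Fin n) (Fin n) ℝ :=
  (1 / √(N : ℝ)) • (S⁻¹ * L ^ (N - 1 - (k : ℕ)))

theorem normalizedDeviation_eq (S : Matrix (Fin n) (Fin n) ℝ) (N : ℕ) (x : Fin n → ℤ) :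
    normalizedDeviation R L S N x = weightedSum R (deviationWeight L S N) (errors R L N x) := by
  simp only [normalizedDeviation, deviation_eq_sum, weightedSum, deviationWeight,
    Matrix.mulVec_sum, Finset.smul_sum, Matrix.smul_mulVec, Matrix.mulVec_mulVec]

theorem sum_deviationWeight_cov (S Ψ : Matrix (Fin n) (Fin n) ℝ) (N : ℕ) :
    ∑ k, deviationWeight L S N k * Ψ * (deviationWeight L S N k)ᵀ =
      S⁻¹ * ((1 / (N : ℝ)) • ∑ ℓ ∈ Finset.range N, L ^ ℓ * Ψ * (L ^ ℓ)ᵀ) * S⁻¹ᵀ := by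
  have h : 1 / √(N : ℝ) * (1 / √(N : ℝ)) = 1 / N := by
    rw [div_mul_div_comm, Real.mul_self_sqrt (Nat.cast_nonneg N), one_mul]
  rw [← Finset.sum_range_reflect, ← Fin.sum_univ_eq_sum_range
    (fun ℓ => L ^ (N - 1 - ℓ) * Ψ * (L ^ (N - 1 - ℓ))ᵀ), Finset.smul_sum, Matrix.mul_sum,
        Matrix.sum_mul]
  refine Finset.sum_congr rfl fun k _ => ?_
  simp only [deviationWeight, Matrix.transpose_smul, Matrix.transpose_mul, Matrix.smul_mul,
    Matrix.mul_smul, smul_smul, h, Matrix.mul_assoc]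

/-- The law of a weighted sum with at least one invertible weight is absolutely continuous,
tested on closed sets. -/
theorem weightedLaw_null (hR : IsQuantizer R) {N : ℕ} {A : Fin N → Matrix (Fin n) (Fin n) ℝ}
    {k₀ : Fin N} (hA : IsUnit (A k₀)) {Z : Set (Fin n → ℝ)} (hZ : IsClosed Z) (hZ0 : volume Z = 0) :
    (weightedLaw hR A : Measure (Fin n → ℝ)) Z = 0 := by
  classical
  -- The weighted sum is a surjective linear map up to a constant; such maps pull null sets back to
  -- null sets.
  let ℓ : (Fin N → Fin n → ℝ) →ₗ[ℝ] (Fin n → ℝ) :=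
    ∑ k, (A k).mulVecLin ∘ₗ LinearMap.proj k
  set c : Fin n → ℝ := ∑ k, A k *ᵥ cellMean R with hc
  have hℓ : ∀ e, weightedSum R A e = ℓ e - c := by
    intro e
    simp [ℓ, weightedSum, hc, Matrix.mulVec_sub]
  have hsurj : Function.Surjective ℓ := by
    intro y
    obtain ⟨u, hu⟩ := (Matrix.mulVec_surjective_iff_isUnit.2 hA) y
    refine ⟨Pi.single k₀ u, ?_⟩
    simp only [ℓ, LinearMap.sum_apply, LinearMap.comp_apply, LinearMap.proj_apply,
      Matrix.mulVecLin_apply]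
    rw [Finset.sum_eq_single k₀, Pi.single_eq_same, hu]
    · intro k _ hk; rw [Pi.single_eq_of_ne hk, Matrix.mulVec_zero]
    · simp
  change ((cellPi R N).map (weightedSum R A)) Z = 0
  rw [Measure.map_apply (continuous_weightedSum A).measurable hZ.measurableSet, cellPi_eq_restrict]
  refine Measure.restrict_le_self.absolutelyContinuous ?_
  have hm : MeasurableSet ((fun y : Fin n → ℝ => y - c) ⁻¹' Z)ᶜ :=
    (hZ.preimage (by fun_prop)).measurableSet.compl
  have h := (ae_comp_linearMap_mem_iff ℓ volume volume hsurj hm).2 (by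
    rw [ae_iff]
    simp only [Set.mem_compl_iff, not_not]
    change volume ((fun y : Fin n → ℝ => y - c) ⁻¹' Z) = 0
    rw [(measurePreserving_sub_right (volume : Measure (Fin n → ℝ)) c).measure_preimage_emb
      (measurableEmbedding_subRight _), hZ0])
  rw [ae_iff] at h
  simp only [Set.mem_compl_iff, not_not, Set.mem_preimage, ← hℓ] at h
  exact h

theorem weightedLaw_real (hR : IsQuantizer R) {N : ℕ} (A : Fin N → Matrix (Fin n) (Fin n) ℝ)
    {B : Set (Fin n → ℝ)} (hB : (weightedLaw hR A : Measure (Fin n → ℝ)) (frontier B) = 0) :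
    (cellPi R N).real (weightedSum R A ⁻¹' B) = (weightedLaw hR A : Measure (Fin n →
        ℝ)).real B := by
  rw [measureReal_def, measureReal_def]
  change _ = (((cellPi R N).map (weightedSum R A)) B).toReal
  rw [Measure.map_apply₀ (continuous_weightedSum A).aemeasurable]
  exact nullMeasurableSet_of_null_frontier hB

/-- The normalized deviation has the distribution of a weighted sum of independent errors. -/
theorem freq_normalizedDeviation (hR : IsQuantizer R) (hres : InfNonresonant (stackedPowers L))
    (S : Matrix (Fin n) (Fin n) ℝ) (N : ℕ) {B : Set (Fin n → ℝ)}
    (hB : (weightedLaw hR (deviationWeight L S N) : Measure (Fin n → ℝ)) (frontier B) = 0) :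
    FreqMeasurable {x | normalizedDeviation R L S N x ∈ B} ∧
      freq {x | normalizedDeviation R L S N x ∈ B} =
        (weightedLaw hR (deviationWeight L S N) : Measure (Fin n → ℝ)).real B := by
  have hC : cellPi R N (frontier (weightedSum R (deviationWeight L S N) ⁻¹' B)) = 0 := by
    have hc := continuous_weightedSum (R := R) (deviationWeight L S N)
    refine measure_mono_null (hc.frontier_preimage_subset B) ?_
    rw [← Measure.map_apply hc.measurable isClosed_frontier.measurableSet]
    exact hB
  have h := freq_of_tendsto (tendsto_fraction_errors (N := N) hR hres hC)
  rw [weightedLaw_real hR _ hB] at h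
  simp only [normalizedDeviation_eq]
  exact h

end Deviation

/-! ### The standard Gaussian measure -/

theorem standardGaussian_eq_withDensity (n : ℕ) :
    (standardGaussian n : Measure (Fin n → ℝ)) =
      volume.withDensity fun u => ENNReal.ofReal (∏ i, gaussianPDFReal 0 1 (u i)) := by
  refine Measure.pi_eq fun s hs => ?_
  have hint : ∀ μ : Fin n → Measure ℝ, (∀ i, μ i = volume.restrict (s i)) →
      Integrable (fun u : Fin n → ℝ => ∏ i, gaussianPDFReal 0 1 (u i)) (Measure.pi μ) := by
    intro μ hμ
    obtain rfl : μ = fun i => volume.restrict (s i) := funext hμ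
    exact Integrable.fintype_prod (f := fun _ => gaussianPDFReal 0 1)
      fun i => (integrable_gaussianPDFReal 0 1).restrict
  rw [withDensity_apply _ (MeasurableSet.univ_pi hs), volume_pi, Measure.restrict_pi_pi,
    ← ofReal_integral_eq_lintegral_ofReal (hint _ fun _ => rfl)
      (.of_forall fun u => Finset.prod_nonneg fun i _ => gaussianPDFReal_nonneg _ _ _),
    integral_fintype_prod_eq_prod (fun _ => gaussianPDFReal 0 1),
    ENNReal.ofReal_prod_of_nonneg fun i _ => integral_nonneg fun u => gaussianPDFReal_nonneg _ _ _]
  refine Finset.prod_congr rfl fun i _ => ?_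
  rw [gaussianReal_apply_eq_integral 0 one_ne_zero]

theorem standardGaussian_absolutelyContinuous (n : ℕ) :
    (standardGaussian n : Measure (Fin n → ℝ)) ≪ volume := by
  rw [standardGaussian_eq_withDensity]
  exact withDensity_absolutelyContinuous _ _

theorem prod_gaussianPDFReal {n : ℕ} (u : Fin n → ℝ) :
    ∏ i, gaussianPDFReal 0 1 (u i) =
      (2 * Real.pi) ^ (-(n : ℝ) / 2) * Real.exp (-(∑ i, u i ^ 2) / 2) := by
  simp only [gaussianPDFReal, NNReal.coe_one, mul_one, sub_zero]
  rw [Finset.prod_mul_distrib, ← Real.exp_sum, ← Finset.sum_div, Finset.sum_neg_distrib,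
    Finset.prod_const, Finset.card_univ, Fintype.card_fin, Real.sqrt_eq_rpow,
    ← Real.rpow_neg (by positivity), ← Real.rpow_natCast, ← Real.rpow_mul (by positivity)]
  congr 2
  ring

theorem standardGaussian_real {n : ℕ} (B : Set (Fin n → ℝ)) :
    (standardGaussian n : Measure (Fin n → ℝ)).real B =
      (2 * Real.pi) ^ (-(n : ℝ) / 2) * ∫ u in B, Real.exp (-(∑ i, u i ^ 2) / 2) := by
  have hnn : ∀ u : Fin n → ℝ, 0 ≤ ∏ i, gaussianPDFReal 0 1 (u i) := fun u =>
    Finset.prod_nonneg fun i _ => gaussianPDFReal_nonneg _ _ _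
  have hint : Integrable fun u : Fin n → ℝ => ∏ i, gaussianPDFReal 0 1 (u i) :=
    Integrable.fintype_prod (f := fun _ => gaussianPDFReal 0 1) fun i =>
        integrable_gaussianPDFReal 0 1
  rw [standardGaussian_eq_withDensity, measureReal_def, withDensity_apply',
    ← ofReal_integral_eq_lintegral_ofReal hint.restrict (.of_forall hnn),
    ENNReal.toReal_ofReal (integral_nonneg hnn), ← integral_const_mul]
  simp only [prod_gaussianPDFReal]

/-! ### The neutral class -/

section Neutral

variable {r : ℕ}

theorem abs_rotation_le_one (t : ℝ) (i j : Fin 2) : |rotation t i j| ≤ 1 := by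
  fin_cases i <;> fin_cases j <;> simp [rotation, Real.abs_cos_le_one, Real.abs_sin_le_one]

/-- The powers of a neutral matrix are uniformly bounded on the centred cell. -/
theorem exists_bound_neutralMatrix {R : (Fin (r * 2) → ℝ) → (Fin (r * 2) → ℤ)} (hR : IsQuantizer R)
    (U : Matrix (Fin (r * 2)) (Fin (r * 2)) ℝ) (t : Fin (r * 2) → ℝ) :
    ∃ M : ℝ, ∀ (s : Fin r → ℝ), ∀ u ∈ cell R,
      |t ⬝ᵥ neutralMatrix U s *ᵥ (u - cellMean R)| ≤ M := by
  -- Enlarging the rotations to all blocks with entries in `[-1, 1]` gives a compact set independent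
  -- of the angles.
  let K : Set ((Fin r → Fin 2 → Fin 2 → ℝ) × (Fin (r * 2) → ℝ)) :=
    (Set.univ.pi fun _ => Set.univ.pi fun _ => Set.univ.pi fun _ => Set.Icc (-1) 1) ×ˢ closure
        (cell R)
  have hK : IsCompact K :=
    (isCompact_univ_pi fun _ => isCompact_univ_pi fun _ => isCompact_univ_pi fun _ =>
      isCompact_Icc).prod hR.jordan.1.isCompact_closure
  let f : (Fin r → Fin 2 → Fin 2 → ℝ) × (Fin (r * 2) → ℝ) → ℝ := fun p =>
    t ⬝ᵥ (∑ k, colBlock U k * Matrix.of (p.1 k) * rowBlock U k) *ᵥ (p.2 - cellMean R)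
  have hf : Continuous f := by
    refine continuous_const.dotProduct (Continuous.matrix_mulVec ?_ (by fun_prop))
    refine continuous_finsetSum _ fun k _ => ?_
    refine (continuous_const.matrix_mul ?_).matrix_mul continuous_const
    exact (continuous_apply k).comp continuous_fst
  obtain ⟨M, hM⟩ := hK.exists_bound_of_continuousOn hf.continuousOn
  refine ⟨M, fun s u hu => hM (fun k => rotation (s k), u) ⟨?_, subset_closure hu⟩⟩
  intro k _ i _ j _
  exact abs_le.1 (abs_rotation_le_one (s k) i j)

theorem tendsto_deviationLaw {U : Matrix (Fin (r * 2)) (Fin (r * 2)) ℝ} (hU : IsUnit U.det)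
    {θ : Fin r → ℝ} (hspec : NondegenerateSpectrum θ)
    {R : (Fin (r * 2) → ℝ) → (Fin (r * 2) → ℤ)} (hR : IsQuantizer R)
    {S : Matrix (Fin (r * 2)) (Fin (r * 2)) ℝ} (hS : S * Sᵀ = limitCov U (cellCov R))
    (hSu : IsUnit S.det) :
    Tendsto (fun N => weightedLaw hR (deviationWeight (neutralMatrix U θ) S N)) atTop
      (𝓝 (standardGaussian (r * 2))) := by
  refine tendsto_weightedLaw hR (fun t => ?_) ?_
  · obtain ⟨M, hM⟩ := exists_bound_neutralMatrix hR U (t ᵥ* S⁻¹)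
    refine ⟨M, fun N k u hu => ?_⟩
    have h := hM (fun l => ((N - 1 - (k : ℕ) : ℕ) : ℝ) * θ l) u hu
    rw [← neutralMatrix_pow hU] at h
    rw [deviationWeight, ← Matrix.dotProduct_mulVec, Matrix.smul_mulVec, dotProduct_smul,
      ← Matrix.mulVec_mulVec, Matrix.dotProduct_mulVec, smul_eq_mul, abs_mul,
      abs_of_nonneg (by positivity), one_div_mul_eq_div]
    gcongr
  · simp only [sum_deviationWeight_cov]
    have h := tendsto_forward_averagedCov hU hspec (cellCov_posDef hR).posSemidef
    have hc : Continuous fun X : Matrix (Fin (r * 2)) (Fin (r * 2)) ℝ => S⁻¹ * X * S⁻¹ᵀ :=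
      (continuous_const.matrix_mul continuous_id).matrix_mul continuous_const
    have h1 : S⁻¹ * limitCov U (cellCov R) * S⁻¹ᵀ = 1 := by
      rw [← hS, ← Matrix.mul_assoc, Matrix.nonsing_inv_mul S hSu, Matrix.one_mul,
        ← Matrix.transpose_mul, Matrix.nonsing_inv_mul S hSu, Matrix.transpose_one]
    rw [← h1]
    exact (hc.tendsto _).comp h

theorem isUnit_det_of_mul_transpose {n : ℕ} {S Φ : Matrix (Fin n) (Fin n) ℝ} (hΦ : Φ.PosDef)
    (h : S * Sᵀ = Φ) : IsUnit S.det := by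
  have := (Matrix.isUnit_iff_isUnit_det _).1 hΦ.isUnit
  rw [← h, Matrix.det_mul] at this
  exact isUnit_of_mul_isUnit_left this

/-- The last error enters with `L ^ 0`, so its weight is a nonzero multiple of `S⁻¹`. -/
theorem isUnit_deviationWeight {n : ℕ} {L S : Matrix (Fin n) (Fin n) ℝ} (hS : IsUnit S.det) {N : ℕ}
    (hN : 1 ≤ N) : IsUnit (deviationWeight L S N ⟨N - 1, by omega⟩) := by
  have h : (1 / √(N : ℝ)) ≠ 0 := by
    have : (0 : ℝ) < N := by exact_mod_cast hN
    positivity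
  rw [deviationWeight, Nat.sub_self, pow_zero, Matrix.mul_one, Matrix.isUnit_iff_isUnit_det,
    Matrix.det_smul]
  exact (isUnit_iff_ne_zero.2 (pow_ne_zero _ h)).mul (Matrix.isUnit_nonsing_inv_det S hS)

end Neutral

end QuantizedLinear

theorem mainTheorem10 (r : ℕ)
    (U : Matrix (Fin (r * 2)) (Fin (r * 2)) ℝ) (hU : IsUnit U.det)
    (θ : Fin r → ℝ) (hθ : ∀ k, θ k ∈ Set.Ioo 0 (2 * Real.pi))
    (hspec : NondegenerateSpectrum θ)
    (L : Matrix (Fin (r * 2)) (Fin (r * 2)) ℝ) (hL : L = neutralMatrix U θ)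
    (hres : IterNonresonant L)
    (R : (Fin (r * 2) → ℝ) → (Fin (r * 2) → ℤ)) (hR : IsQuantizer R) :
    Tendsto (averagedCov L (cellCov R)) atTop (𝓝 (limitCov U (cellCov R))) ∧
    (limitCov U (cellCov R)).PosDef ∧
    ∀ S : Matrix (Fin (r * 2)) (Fin (r * 2)) ℝ, S * Sᵀ = limitCov U (cellCov R) →
      (∃ D : ℕ → ProbabilityMeasure (Fin (r * 2) → ℝ),
        (∀ N : ℕ, 1 ≤ N → IsDistributed (normalizedDeviation R L S N) (D N)) ∧
        Tendsto D atTop (𝓝 (standardGaussian (r * 2)))) ∧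
      ∀ B : Set (Fin (r * 2) → ℝ), JordanMeasurable B →
        (∀ N : ℕ, 1 ≤ N → FreqMeasurable {x | normalizedDeviation R L S N x ∈ B}) ∧
        Tendsto (fun N : ℕ => freq {x | normalizedDeviation R L S N x ∈ B}) atTop
          (𝓝 ((2 * Real.pi) ^ (-((r * 2 : ℕ) : ℝ) / 2) *
            ∫ u in B, Real.exp (-(∑ i, u i ^ 2) / 2))) := by
  have hΨ := cellCov_posDef hR
  have hΦ := limitCov_posDef hU hΨ
  subst hL
  refine ⟨tendsto_averagedCov hU hspec hΨ.posSemidef, hΦ, fun S hS => ?_⟩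
  have hSu := isUnit_det_of_mul_transpose hΦ hS
  have hlim := tendsto_deviationLaw hU hspec hR hS hSu
  refine ⟨⟨fun N => weightedLaw hR (deviationWeight (neutralMatrix U θ) S N), fun N _ B _ hB0 =>
    freq_normalizedDeviation hR hres.2 S N hB0, hlim⟩, fun B hB => ?_⟩
  -- For `N = 0` the law is a point mass, so null boundaries are guaranteed only from `N = 1` on.
  have hfreq : ∀ N : ℕ, 1 ≤ N → _ := fun N hN => freq_normalizedDeviation hR hres.2 S N
    (weightedLaw_null hR (isUnit_deviationWeight hSu hN) isClosed_frontier hB.2)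
  refine ⟨fun N hN => (hfreq N hN).1, ?_⟩
  have h := ProbabilityMeasure.tendsto_measure_of_null_frontier_of_tendsto' hlim (E := B)
    (standardGaussian_absolutelyContinuous _ hB.2)
  rw [← standardGaussian_real]
  refine ((ENNReal.tendsto_toReal (measure_ne_top _ B)).comp h).congr' ?_
  filter_upwards [eventually_ge_atTop 1] with N hN
  exact (hfreq N hN).2.symm
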